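/- Let $\mathfrak B_n$ be the group of all bijections $\sigma$ of $\{\pm1,\dots,\pm n\}$ with $\sigma(-i)=-\sigma(i)$, and write $\sigma_i=\sigma(i)$. Its generators are $s_0$, which exchanges $1$ and $-1$, and $s_i$ ($1\le i\le n-1$), which exchanges $i$ with $i+1$ and $-i$ with $-(i+1)$. For $n\ge 2$ let $\mathfrak D_n\subset\mathfrak B_n$ be the subgroup of those $\sigma$ with an even number of negative entries among $\sigma_1,\dots,\sigma_n$; its generators are $s_1,\dots,s_{n-1}$ and $s_0^D$, which exchanges $1$ with $-2$ and $-1$ with $2$. In each of these groups let $\ell(\sigma)$ be the length of a shortest expression of $\sigma$ as a product of generators, and let $\mathrm{des}_B\,\sigma$, respectively $\mathrm{des}_D\,\sigma$, be the number of generators $s$ with $\ell(\sigma s)<\ell(\sigma)$. Put $$B_n(x)=\sum_{\sigma\in\mathfrak B_n}x^{\mathrm{des}_B\sigma},\quad B_n^+(x)=\sum_{\sigma\in\mathfrak B_n,\ \sigma_n>0}x^{\mathrm{des}_B\sigma},\quad D_n(x)=\sum_{\sigma\in\mathfrak D_n}x^{\mathrm{des}_D\sigma},\quad D_n^+(x)=\sum_{\sigma\in\mathfrak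 D_n,\ \sigma_n>0}x^{\mathrm{des}_D\sigma}.$$ For real polynomials $f,g$ with positive leading coefficients and only real zeros, $r_1\ge r_2\ge\cdots$ and $s_1\ge s_2\ge\cdots$ respectively, listed with multiplicity, we say that $g$ interlaces $f$ if $\deg f-\deg g\in\{0,1\}$ and $\cdots\le s_2\le r_2\le s_1\le r_1$. Then: (i) For every $n\ge1$, the polynomial $B_n^+(x)$ interlaces $x^nB_n^+(1/x)$ (in particular, both have only real zeros), $B_n(x)=B_n^+(x)+x^nB_n^+(1/x)$, and $B_n(x)$ has only real zeros. (ii) For every $n\ge2$, the polynomial $D_n^+(x)$ interlaces $x^nD_n^+(1/x)$ (in particular, both have only real zeros), $D_n(x)=D_n^+(x)+x^nD_n^+(1/x)$, and $D_n(x)$ has only real zeros. -/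

import Mathlib

open Polynomial

/-- The set `±[n] = {±1, …, ±n}`. -/
abbrev SignedIndex (n : ℕ) : Type :=
  {k : ℤ // k ∈ (Finset.Icc (-(n : ℤ)) (n : ℤ)).erase 0}

namespace SignedIndex

instance (n : ℕ) : Neg (SignedIndex n) where
  neg k := ⟨-k.1, by
    have h := k.2
    simp only [Finset.mem_erase, Finset.mem_Icc, ne_eq] at h ⊢
    omega⟩

/-- The positive elements `1, …, n` of `±[n]`, indexed from `0`: `pos i` is `i + 1`. -/
def pos {n : ℕ} (i : Fin n) : SignedIndex n :=
  ⟨(i : ℤ) + 1, by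
    have h := i.2
    simp only [Finset.mem_erase, Finset.mem_Icc, ne_eq]
    omega⟩

theorem neg_neg' {n : ℕ} (k : SignedIndex n) : -(-k) = k :=
  Subtype.ext (Int.neg_neg k.1)

theorem neg_inj' {n : ℕ} {a b : SignedIndex n} : -a = -b ↔ a = b :=
  ⟨fun h => by rw [← neg_neg' a, h, neg_neg'], fun h => by rw [h]⟩

theorem neg_ne' {n : ℕ} (k : SignedIndex n) : -k ≠ k := fun h => by
  have h1 : -k.1 = k.1 := congrArg Subtype.val h
  have h2 := k.2
  simp only [Finset.mem_erase, Finset.mem_Icc, ne_eq] at h2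
  omega

end SignedIndex

/-- The group `𝔅ₙ` of signed permutations: all bijections `π` of `±[n]` such that
`π (-i) = -π i` for all `i`; the product is composition. -/
def signedPerm (n : ℕ) : Subgroup (Equiv.Perm (SignedIndex n)) where
  carrier := {π | ∀ k, π (-k) = -π k}
  one_mem' := fun _ => rfl
  mul_mem' := fun {a b} ha hb k => by
    rw [Equiv.Perm.mul_apply, Equiv.Perm.mul_apply, hb k, ha]
  inv_mem' := fun {a} ha k => by
    rw [Equiv.Perm.inv_eq_iff_eq, ha]
    exact congrArg Neg.neg (Equiv.apply_symm_apply a k).symm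

/-- The entry `π_{i+1} = π (i + 1)` of the one-line notation `(π₁, …, πₙ)`, as an integer. -/
def entry {n : ℕ} (π : signedPerm n) (i : Fin n) : ℤ :=
  (π.1 (SignedIndex.pos i)).1

/-- `π` is an even signed permutation (an element of `𝔇ₙ`): the one-line notation has an even
number of negative entries. -/
def IsEvenSigned {n : ℕ} (π : signedPerm n) : Prop :=
  Even (Finset.univ.filter fun i : Fin n => entry π i < 0).card

/-- The last entry `πₙ` of the one-line notation is positive. -/
def LastPos {n : ℕ} (π : signedPerm n) : Prop :=
  ∀ i : Fin n, (i : ℕ) + 1 = n → 0 < entry π i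

/-- The bijection of `±[n]` that exchanges `a` with `b` and `-a` with `-b`. -/
def reflPerm {n : ℕ} (a b : SignedIndex n) : Equiv.Perm (SignedIndex n) :=
  if a = -b then Equiv.swap a b else Equiv.swap a b * Equiv.swap (-a) (-b)

theorem reflPerm_mem {n : ℕ} (a b : SignedIndex n) : reflPerm a b ∈ signedPerm n := by
  intro k
  have h1 := @SignedIndex.neg_neg' n
  have h2 := @SignedIndex.neg_inj' n
  have h3 := @SignedIndex.neg_ne' n
  unfold reflPerm
  split_ifs with h
  · subst h
    simp only [Equiv.swap_apply_def]
    grind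
  · simp only [Equiv.Perm.mul_apply, Equiv.swap_apply_def]
    grind

/-- The reflection of `𝔅ₙ` that exchanges `a` with `b` and `-a` with `-b`. -/
def signedRefl {n : ℕ} (a b : SignedIndex n) : signedPerm n := ⟨reflPerm a b, reflPerm_mem a b⟩

/-- The generators of type `B`: `s₀` exchanges `1` and `-1`, and, for `1 ≤ i ≤ n - 1`,
`sᵢ` exchanges `i` and `i + 1` (and `-i` and `-(i + 1)`). -/
def genB (n : ℕ) (i : Fin n) : signedPerm n :=
  if (i : ℕ) = 0 then signedRefl (SignedIndex.pos i) (-SignedIndex.pos i)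
  else signedRefl (SignedIndex.pos ⟨(i : ℕ) - 1, by omega⟩) (SignedIndex.pos i)

/-- The generators of type `D` (for `n ≥ 2`): `s₀` exchanges `1` and `-2` (and `-1` and `2`),
and, for `1 ≤ i ≤ n - 1`, `sᵢ` exchanges `i` and `i + 1` (and `-i` and `-(i + 1)`).
For `n = 1`, which is never used, `s₀` is the identity. -/
def genD (n : ℕ) (i : Fin n) : signedPerm n :=
  if (i : ℕ) = 0 then
    if h : 1 < n then signedRefl (SignedIndex.pos i) (-SignedIndex.pos ⟨1, h⟩) else 1
  else signedRefl (SignedIndex.pos ⟨(i : ℕ) - 1, by omega⟩) (SignedIndex.pos i)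

/-- The length of `g` with respect to generators `s` (involutions): the number of
generators in a shortest expression of `g` as a product of generators. -/
noncomputable def wordLength {G ι : Type*} [Group G] (s : ι → G) (g : G) : ℕ :=
  sInf {k | ∃ w : List ι, w.length = k ∧ (w.map s).prod = g}

open Classical in
/-- The number of descents of `g`: those `i` with `ℓ(g sᵢ) < ℓ(g)`. -/
noncomputable def des {G ι : Type*} [Group G] [Fintype ι] (s : ι → G) (g : G) : ℕ :=
  (Finset.univ.filter fun i : ι => wordLength s (g * s i) < wordLength s g).card

open Classical in
/-- The Eulerian polynomial `Bₙ(x) = ∑_{σ ∈ 𝔅ₙ} x ^ des_B σ`. -/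
noncomputable def eulerianB (n : ℕ) : ℝ[X] :=
  ∑ σ : signedPerm n, X ^ des (genB n) σ

open Classical in
/-- The Eulerian polynomial `Dₙ(x) = ∑_{σ ∈ 𝔇ₙ} x ^ des_D σ`. -/
noncomputable def eulerianD (n : ℕ) : ℝ[X] :=
  ∑ σ : signedPerm n with IsEvenSigned σ, X ^ des (genD n) σ

open Classical in
/-- The half Eulerian polynomial `Bₙ⁺(x) = ∑_{σ ∈ 𝔅ₙ, σₙ > 0} x ^ des_B σ`. -/
noncomputable def halfB (n : ℕ) : ℝ[X] :=
  ∑ σ : signedPerm n with LastPos σ, X ^ des (genB n) σ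

open Classical in
/-- The half Eulerian polynomial `Dₙ⁺(x) = ∑_{σ ∈ 𝔇ₙ, σₙ > 0} x ^ des_D σ`. -/
noncomputable def halfD (n : ℕ) : ℝ[X] :=
  ∑ σ : signedPerm n with IsEvenSigned σ ∧ LastPos σ, X ^ des (genD n) σ

theorem natDegree_halfB_le (n : ℕ) : (halfB n).natDegree ≤ n := by
  classical
  refine natDegree_sum_le_of_forall_le _ _ fun σ _ => ?_
  rw [natDegree_X_pow]
  exact (Finset.card_le_univ _).trans (Fintype.card_fin n).le

theorem natDegree_halfD_le (n : ℕ) : (halfD n).natDegree ≤ n := by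
  classical
  refine natDegree_sum_le_of_forall_le _ _ fun σ _ => ?_
  rw [natDegree_X_pow]
  exact (Finset.card_le_univ _).trans (Fintype.card_fin n).le

/-- For a polynomial of degree at most `n`, `reflect n p` is `x ^ n p(1/x)`. -/
theorem eval_reflect_eq (n : ℕ) (p : ℝ[X]) (hp : p.natDegree ≤ n) (x : ℝ) (hx : x ≠ 0) :
    (reflect n p).eval x = x ^ n * p.eval (1 / x) := by
  have hx' : x * x⁻¹ = 1 := mul_inv_cancel₀ hx
  let _ : Invertible x⁻¹ := ⟨x, hx', by rw [mul_comm, hx']⟩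
  have h : (reflect n p).eval x * x⁻¹ ^ n = p.eval x⁻¹ :=
    eval₂_reflect_mul_pow (RingHom.id ℝ) x⁻¹ n p hp
  rw [one_div, ← h, mul_comm, mul_assoc, ← mul_pow, mul_comm x⁻¹, hx', one_pow, mul_one]

/-- A nonzero real polynomial all of whose complex zeros are real. -/
def HasOnlyRealZeros (p : ℝ[X]) : Prop :=
  p ≠ 0 ∧ ∀ z : ℂ, aeval z p = 0 → z.im = 0

/-- `g` interlaces `f`: both are real-rooted with positive leading coefficients, and their zeros
`r₁ ≥ r₂ ≥ ⋯` (of `f`) and `s₁ ≥ s₂ ≥ ⋯` (of `g`), listed with multiplicity, satisfy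
`⋯ ≤ s₂ ≤ r₂ ≤ s₁ ≤ r₁`; the chain runs through all the zeros, so that `f` has as many zeros
as `g` or one more. -/
def Interlaces (g f : ℝ[X]) : Prop :=
  HasOnlyRealZeros g ∧ HasOnlyRealZeros f ∧ 0 < g.leadingCoeff ∧ 0 < f.leadingCoeff ∧
  ∃ r s : List ℝ, (r : Multiset ℝ) = f.roots ∧ (s : Multiset ℝ) = g.roots ∧
    r.Pairwise (· ≥ ·) ∧ s.Pairwise (· ≥ ·) ∧
    (r.length = s.length ∨ r.length = s.length + 1) ∧
    (∀ (i : ℕ) (hr : i < r.length) (hs : i < s.length), s[i] ≤ r[i]) ∧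
    (∀ (i : ℕ) (hr : i + 1 < r.length) (hs : i < s.length), r[i + 1] ≤ s[i])

/-! Write B⁺ₙ, B⁻ₙ for the sums over signed permutations with last entry positive, negative.
Changing all signs turns descents into ascents, so B⁻ₙ(x) = xⁿB⁺ₙ(1/x) and Bₙ = B⁺ₙ + B⁻ₙ; the same
holds in type D. The zeros are controlled by merging the two halves into one polynomial in t, with
t² = x. If Aₙ is the type A Eulerian polynomial with constant term 1, then t B⁺ₙ(t²) + B⁻ₙ(t²) = t
(1+t)ⁿ Aₙ(t) (`expand_lastSumB`), so B⁺ₙ and B⁻ₙ/x come from the even and odd parts of (1+t)ⁿAₙ(t).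
If that polynomial has no zero with Re t ≥ 0, the Hermite–Biehler theorem (`IsHurwitz.interlaces`)
gives the interlacing and the real zeros of the sum.

Type D reduces to type B by D⁺ₙ = B⁺ₙ - n B⁻ₙ₋₁ (`lastSumB_eq_lastSumD_add`), hence D⁻ₙ = B⁻ₙ - n x
B⁺ₙ₋₁, and the merged polynomial becomes (1+t)ⁿ⁻¹((1+t)Aₙ - n t Aₙ₋₁).

Both merged polynomials are self-reciprocal, so it suffices to exclude zeros in the half disc Re t ≥
0, |t| ≤ 1 (`isHurwitz_of_symm`). There the recurrence for Aₙ, divided by t(1-t)Aₙ₋₁ or t(1-t²)Aₙ₋₁,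
becomes a sum of terms with nonnegative real part, one of them positive; the logarithmic derivative
of Aₙ₋₁ is handled by its zeros lying in the left half-plane (`isHurwitz_eulerianA`,
`isHurwitz_typeD`). -/

/-! ### Word length from a statistic on the group -/

/-- If a statistic `f` changes by `±2` under right multiplication by generators and every
non-identity element admits a decreasing generator, then `f` is twice the word length. -/
theorem two_mul_wordLength_eq {G ι : Type*} [Group G] (s : ι → G) (P : G → Prop) (f : G → ℕ)
    (hs : ∀ i, s i * s i = 1) (h1 : f 1 = 0)
    (hstep : ∀ g i, P g → f (g * s i) = f g + 2 ∨ f g = f (g * s i) + 2)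
    (hP1 : P 1) (hP : ∀ g i, P g → P (g * s i))
    (hdesc : ∀ g, P g → g ≠ 1 → ∃ i, f (g * s i) < f g) (g : G) (hg : P g) :
    2 * wordLength s g = f g := by
  have hex : ∀ k g, P g → f g = k → ∃ w : List ι, 2 * w.length = f g ∧ (w.map s).prod = g := by
    intro k
    induction k using Nat.strong_induction_on with
    | _ k ih =>
      intro g hg hk
      by_cases hne : g = 1
      · exact ⟨[], by simp [hne, h1], by simp [hne]⟩
      obtain ⟨i, hi⟩ := hdesc g hg hne
      obtain ⟨w, hw, hwp⟩ := ih _ (hk ▸ hi) (g * s i) (hP g i hg) rfl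
      refine ⟨w ++ [i], ?_, ?_⟩
      · rcases hstep g i hg with h | h
        · omega
        · simp only [List.length_append, List.length_singleton]
          omega
      · simp [hwp, mul_assoc, hs]
  have hle : ∀ w : List ι, P (w.map s).prod ∧ f (w.map s).prod ≤ 2 * w.length := by
    intro w
    induction w using List.reverseRecOn with
    | nil => simp [h1, hP1]
    | append_singleton w i ih =>
      simp only [List.map_append, List.map_cons, List.map_nil, List.prod_append, List.prod_cons,
        List.prod_nil, mul_one, List.length_append, List.length_singleton]
      refine ⟨hP _ i ih.1, ?_⟩
      rcases hstep _ i ih.1 with h | h <;> omega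
  obtain ⟨w, hw, hwp⟩ := hex _ g hg rfl
  -- An infimum of an empty set would be 0, so attainment needs the word just found. In type D,
  -- elements with an odd number of negative entries have no word at all, whence the restriction to
  -- `P`.
  have hmem : wordLength s g ∈ {k | ∃ w : List ι, w.length = k ∧ (w.map s).prod = g} :=
    Nat.sInf_mem ⟨_, w, rfl, hwp⟩
  obtain ⟨v, hv, hvp⟩ := hmem
  have h2 := (hle v).2
  rw [hvp, hv] at h2
  have h3 : wordLength s g ≤ w.length := Nat.sInf_le ⟨w, rfl, hwp⟩
  omega

theorem wordLength_mul_lt_iff {G ι : Type*} [Group G] (s : ι → G) (P : G → Prop) (f : G → ℕ)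
    (hs : ∀ i, s i * s i = 1) (h1 : f 1 = 0)
    (hstep : ∀ g i, P g → f (g * s i) = f g + 2 ∨ f g = f (g * s i) + 2)
    (hP1 : P 1) (hP : ∀ g i, P g → P (g * s i))
    (hdesc : ∀ g, P g → g ≠ 1 → ∃ i, f (g * s i) < f g) (g : G) (hg : P g) (i : ι) :
    wordLength s (g * s i) < wordLength s g ↔ f (g * s i) < f g := by
  have e1 := two_mul_wordLength_eq s P f hs h1 hstep hP1 hP hdesc g hg
  have e2 := two_mul_wordLength_eq s P f hs h1 hstep hP1 hP hdesc _ (hP g i hg)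
  omega

/-! ### Signed permutations, reflections and one-line notation -/

namespace SignedIndex

theorem val_neg {n : ℕ} (k : SignedIndex n) : (-k).1 = -k.1 := rfl

theorem val_pos {n : ℕ} (i : Fin n) : (pos i).1 = (i : ℤ) + 1 := rfl

theorem val_ne_zero {n : ℕ} (k : SignedIndex n) : k.1 ≠ 0 := (Finset.mem_erase.1 k.2).1

theorem val_le {n : ℕ} (k : SignedIndex n) : k.1 ≤ n :=
  (Finset.mem_Icc.1 (Finset.mem_erase.1 k.2).2).2

theorem neg_le_val {n : ℕ} (k : SignedIndex n) : -(n : ℤ) ≤ k.1 :=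
  (Finset.mem_Icc.1 (Finset.mem_erase.1 k.2).2).1

end SignedIndex

theorem signedPerm_apply_neg {n : ℕ} (σ : signedPerm n) (k : SignedIndex n) :
    σ.1 (-k) = -σ.1 k := σ.2 k

theorem signedPerm_ext {n : ℕ} {σ τ : signedPerm n} (h : ∀ i, entry σ i = entry τ i) : σ = τ := by
  apply Subtype.ext
  apply Equiv.ext
  intro k
  have hpos : ∀ i, σ.1 (SignedIndex.pos i) = τ.1 (SignedIndex.pos i) :=
    fun i => Subtype.ext (h i)
  have h0 := k.val_ne_zero
  have h1 := k.val_le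
  have h2 := k.neg_le_val
  rcases lt_or_gt_of_ne h0 with hk | hk
  · have e : k = -SignedIndex.pos ⟨(-k.1 - 1).toNat, by omega⟩ := by
      apply Subtype.ext
      rw [SignedIndex.val_neg, SignedIndex.val_pos]
      simp only
      omega
    rw [e, signedPerm_apply_neg, signedPerm_apply_neg, hpos]
  · have e : k = SignedIndex.pos ⟨(k.1 - 1).toNat, by omega⟩ := by
      apply Subtype.ext
      rw [SignedIndex.val_pos]
      simp only
      omega
    rw [e, hpos]

theorem signedRefl_apply_val {n : ℕ} (a b c : SignedIndex n) :
    ((signedRefl a b).1 c).1 = if c.1 = a.1 then b.1 else if c.1 = b.1 then a.1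
      else if c.1 = -a.1 then -b.1 else if c.1 = -b.1 then -a.1 else c.1 := by
  have h1 := @SignedIndex.neg_neg' n
  have h2 := @SignedIndex.neg_inj' n
  have h3 := @SignedIndex.neg_ne' n
  have h4 : ∀ x y : SignedIndex n, x.1 = y.1 ↔ x = y := fun x y => Subtype.ext_iff.symm
  simp only [signedRefl, reflPerm, ← SignedIndex.val_neg, h4]
  split_ifs <;> simp only [Equiv.Perm.mul_apply, Equiv.swap_apply_def] <;> grind

theorem signedRefl_mul_self {n : ℕ} (a b : SignedIndex n) :
    signedRefl a b * signedRefl a b = 1 := by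
  apply Subtype.ext
  apply Equiv.ext
  intro c
  apply Subtype.ext
  change ((signedRefl a b).1 ((signedRefl a b).1 c)).1 = c.1
  have ha := a.val_ne_zero
  have hb := b.val_ne_zero
  rw [signedRefl_apply_val, signedRefl_apply_val]
  split_ifs <;> omega

theorem signedRefl_apply_left {n : ℕ} (a b : SignedIndex n) : (signedRefl a b).1 a = b := by
  apply Subtype.ext
  rw [signedRefl_apply_val]
  simp

theorem signedRefl_apply_right {n : ℕ} (a b : SignedIndex n) : (signedRefl a b).1 b = a := by
  apply Subtype.ext
  rw [signedRefl_apply_val]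
  split_ifs <;> omega

/-! ### Inversions, length and descents in types B and D -/

/-- Inversions of `σ` on `±[n]`, where the pairs `(c, -c)` have weight `z`. -/
noncomputable def invStat {n : ℕ} (z : ℕ) (σ : signedPerm n) : ℕ :=
  ∑ p : SignedIndex n × SignedIndex n,
    if p.1.1 < p.2.1 ∧ (σ.1 p.2).1 < (σ.1 p.1).1 then (if p.1 = -p.2 then z else 1) else 0

theorem invStat_one {n : ℕ} (z : ℕ) : invStat z (1 : signedPerm n) = 0 := by
  refine Finset.sum_eq_zero fun p _ => if_neg ?_
  rintro ⟨h1, h2⟩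
  exact absurd h1 (not_lt.2 h2.le)

/-- Reindexing by the reflection turns the inversions of the product into pairs that are inverted by
`σ` and ordered after the reflection. By `hadj`, the reflection reverses only `(a, b)` and its
mirror image `(-b, -a)`, up to pairs of weight 0, so the sum changes there alone. When `a = -b` the
two pairs coincide, and the weight 2 makes up for it. With mirror images both counted, the statistic
is twice the Coxeter length, for weight 2 in type B and weight 0 in type D. -/
theorem invStat_mul_signedRefl {n : ℕ} (z : ℕ) (σ : signedPerm n) (a b : SignedIndex n)
    (hab : a.1 < b.1) (hz : a = -b → z = 2)
    (hadj : ∀ c d : SignedIndex n, (c = -d → z ≠ 0) → c.1 < d.1 →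
      ((signedRefl a b).1 d).1 < ((signedRefl a b).1 c).1 → (c = a ∧ d = b) ∨ (c = -b ∧ d = -a))
    (hσ : (σ.1 a).1 < (σ.1 b).1) :
    invStat z (σ * signedRefl a b) = invStat z σ + 2 := by
  set s := signedRefl a b with hs
  have hss : ∀ c, s.1 (s.1 c) = c := fun c =>
    congrArg (fun τ : signedPerm n => τ.1 c) (signedRefl_mul_self a b)
  have hsa : s.1 a = b := signedRefl_apply_left a b
  have hsb : s.1 b = a := signedRefl_apply_right a b
  have hneg : ∀ c d : SignedIndex n, s.1 c = -s.1 d ↔ c = -d := fun c d => by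
    rw [← signedPerm_apply_neg, s.1.injective.eq_iff]
  have e1 : invStat z (σ * s) = ∑ p : SignedIndex n × SignedIndex n,
      if (s.1 p.1).1 < (s.1 p.2).1 ∧ (σ.1 p.2).1 < (σ.1 p.1).1
        then (if p.1 = -p.2 then z else 1) else 0 := by
    unfold invStat
    rw [← Equiv.sum_comp (s.1.prodCongr s.1)]
    refine Finset.sum_congr rfl fun p _ => ?_
    have h2 : ∀ c, (σ * s).1 (s.1 c) = σ.1 c := fun c => by
      change σ.1 (s.1 (s.1 c)) = _
      rw [hss]
    simp only [Equiv.prodCongr_apply, Prod.map_fst, Prod.map_snd, h2, hneg]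
  have e2 : ∀ p : SignedIndex n × SignedIndex n,
      (if (s.1 p.1).1 < (s.1 p.2).1 ∧ (σ.1 p.2).1 < (σ.1 p.1).1
        then (if p.1 = -p.2 then z else 1) else 0) =
      (if p.1.1 < p.2.1 ∧ (σ.1 p.2).1 < (σ.1 p.1).1 then (if p.1 = -p.2 then z else 1) else 0) +
      (if p = (b, a) ∨ p = (-a, -b) then (if p.1 = -p.2 then z else 1) else 0) := by
    rintro ⟨c, d⟩
    simp only [Prod.mk.injEq]
    by_cases hsp : (c = b ∧ d = a) ∨ (c = -a ∧ d = -b)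
    · have h1 : (s.1 c).1 < (s.1 d).1 ∧ (σ.1 d).1 < (σ.1 c).1 := by
        rcases hsp with ⟨rfl, rfl⟩ | ⟨rfl, rfl⟩
        · rw [hsa, hsb]; exact ⟨hab, hσ⟩
        · simp only [signedPerm_apply_neg, SignedIndex.val_neg, hsa, hsb]; omega
      have h2 : ¬(c.1 < d.1 ∧ (σ.1 d).1 < (σ.1 c).1) := by
        rcases hsp with ⟨rfl, rfl⟩ | ⟨rfl, rfl⟩
        · omega
        · rw [SignedIndex.val_neg, SignedIndex.val_neg]; omega
      rw [if_pos hsp, if_pos h1, if_neg h2, zero_add]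
    · rw [if_neg hsp, add_zero]
      by_cases hw : (if c = -d then z else 1) = 0
      · simp [hw]
      have hw' : c = -d → z ≠ 0 := fun h => by rwa [if_pos h] at hw
      congr 1
      refine propext (and_congr_left fun hlt => ?_)
      have hcd : c.1 ≠ d.1 := fun h => by rw [Subtype.ext h] at hlt; exact lt_irrefl _ hlt
      have hcd' : (s.1 c).1 ≠ (s.1 d).1 := fun h =>
        hcd (congrArg Subtype.val (s.1.injective (Subtype.ext h)))
      constructor
      · intro h
        by_contra hn
        have := hadj (s.1 c) (s.1 d) (fun h => hw' ((hneg c d).1 h)) h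
          (by rw [hss, hss]; omega)
        apply hsp
        rcases this with ⟨h1, h2⟩ | ⟨h1, h2⟩
        · left
          rw [← hss c, ← hss d, h1, h2]
          exact ⟨hsa, hsb⟩
        · right
          rw [← hss c, ← hss d, h1, h2, signedPerm_apply_neg, signedPerm_apply_neg, hsa, hsb]
          exact ⟨rfl, rfl⟩
      · intro h
        by_contra hn
        rcases hadj c d hw' h (by omega) with ⟨rfl, rfl⟩ | ⟨rfl, rfl⟩
        · omega
        · simp only [signedPerm_apply_neg, SignedIndex.val_neg] at hlt
          omega
  rw [e1, Finset.sum_congr rfl fun p _ => e2 p, Finset.sum_add_distrib]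
  change invStat z σ + _ = _
  congr 1
  rw [← Finset.sum_filter]
  have e3 : (Finset.univ.filter fun p : SignedIndex n × SignedIndex n =>
      p = (b, a) ∨ p = (-a, -b)) = {(b, a), (-a, -b)} := by
    ext p; simp
  rw [e3]
  have hN := @SignedIndex.neg_neg' n
  by_cases h : a = -b
  · have h' : b = -a := by rw [h, hN]
    have e4 : ((-a, -b) : SignedIndex n × SignedIndex n) = (b, a) := by rw [← h, ← h']
    rw [e4, Finset.pair_eq_singleton, Finset.sum_singleton, if_pos h', hz h]
  · have h' : b ≠ -a := fun h' => h (by rw [h', hN])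
    have h'' : -a ≠ - -b := fun e => h (SignedIndex.neg_inj'.1 e)
    rw [Finset.sum_pair fun e => h' (Prod.mk.inj e).1, if_neg h', if_neg h'']

theorem invStat_mul_signedRefl_cases {n : ℕ} (z : ℕ) (σ : signedPerm n) (a b : SignedIndex n)
    (hab : a.1 < b.1) (hz : a = -b → z = 2)
    (hadj : ∀ c d : SignedIndex n, (c = -d → z ≠ 0) → c.1 < d.1 →
      ((signedRefl a b).1 d).1 < ((signedRefl a b).1 c).1 → (c = a ∧ d = b) ∨ (c = -b ∧ d = -a)) :
    ((σ.1 a).1 < (σ.1 b).1 ∧ invStat z (σ * signedRefl a b) = invStat z σ + 2) ∨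
    ((σ.1 b).1 < (σ.1 a).1 ∧ invStat z σ = invStat z (σ * signedRefl a b) + 2) := by
  have hne : (σ.1 a).1 ≠ (σ.1 b).1 := fun h => by
    have := congrArg Subtype.val (σ.1.injective (Subtype.ext h))
    omega
  rcases lt_or_gt_of_ne hne with h | h
  · exact Or.inl ⟨h, invStat_mul_signedRefl z σ a b hab hz hadj h⟩
  · refine Or.inr ⟨h, ?_⟩
    have := invStat_mul_signedRefl z (σ * signedRefl a b) a b hab hz hadj (by
      change (σ.1 ((signedRefl a b).1 a)).1 < (σ.1 ((signedRefl a b).1 b)).1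
      rwa [signedRefl_apply_left, signedRefl_apply_right])
    rwa [mul_assoc, signedRefl_mul_self, mul_one] at this

theorem genB_mul_self {n : ℕ} (i : Fin n) : genB n i * genB n i = 1 := by
  unfold genB
  split_ifs <;> exact signedRefl_mul_self _ _

theorem genD_mul_self {n : ℕ} (i : Fin n) : genD n i * genD n i = 1 := by
  unfold genD
  split_ifs
  · exact signedRefl_mul_self _ _
  · exact one_mul 1
  · exact signedRefl_mul_self _ _

/-- The descent condition at position `i` common to types `B` and `D`, for `i ≠ 0`. -/
def IsAdjDescent {n : ℕ} (w : Fin n → ℤ) (i : Fin n) : Prop :=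
  w i < w ⟨(i : ℕ) - 1, by omega⟩

/-- The type `B` descent condition on a signed word. -/
def IsDescentB {n : ℕ} (w : Fin n → ℤ) (i : Fin n) : Prop :=
  if (i : ℕ) = 0 then w i < 0 else IsAdjDescent w i

/-- The type `D` descent condition on a signed word. -/
def IsDescentD {n : ℕ} (w : Fin n → ℤ) (i : Fin n) : Prop :=
  if (i : ℕ) = 0 then ∃ h : 1 < n, w i + w ⟨1, h⟩ < 0 else IsAdjDescent w i

theorem invStat_mul_adj {n : ℕ} (z : ℕ) (σ : signedPerm n) (i : Fin n) (hi : (i : ℕ) ≠ 0) :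
    let s := signedRefl (SignedIndex.pos ⟨(i : ℕ) - 1, by omega⟩) (SignedIndex.pos i)
    (¬IsAdjDescent (entry σ) i ∧ invStat z (σ * s) = invStat z σ + 2) ∨
    (IsAdjDescent (entry σ) i ∧ invStat z σ = invStat z (σ * s) + 2) := by
  intro s
  have h := invStat_mul_signedRefl_cases z σ (SignedIndex.pos ⟨(i : ℕ) - 1, by omega⟩)
    (SignedIndex.pos i) (by simp only [SignedIndex.val_pos]; omega)
    (fun h => by
      have := congrArg Subtype.val h
      simp only [SignedIndex.val_pos, SignedIndex.val_neg] at this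
      omega)
    (fun c d _ hcd hlt => by
      have hc := c.val_ne_zero
      have hd := d.val_ne_zero
      simp only [signedRefl_apply_val, SignedIndex.val_pos] at hlt
      simp only [Subtype.ext_iff, SignedIndex.val_pos, SignedIndex.val_neg]
      split_ifs at hlt <;> omega)
  unfold IsAdjDescent entry
  rcases h with ⟨h1, h2⟩ | ⟨h1, h2⟩
  · exact Or.inl ⟨not_lt.2 h1.le, h2⟩
  · exact Or.inr ⟨h1, h2⟩

theorem invStat_mul_genB {n : ℕ} (σ : signedPerm n) (i : Fin n) :
    (¬IsDescentB (entry σ) i ∧ invStat 2 (σ * genB n i) = invStat 2 σ + 2) ∨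
    (IsDescentB (entry σ) i ∧ invStat 2 σ = invStat 2 (σ * genB n i) + 2) := by
  unfold IsDescentB genB
  by_cases hi : (i : ℕ) = 0
  · simp only [if_pos hi]
    have h := invStat_mul_signedRefl_cases 2 σ (-SignedIndex.pos i) (SignedIndex.pos i)
      (by simp only [SignedIndex.val_pos, SignedIndex.val_neg]; omega) (fun _ => rfl)
      (fun c d _ hcd hlt => by
        have hc := c.val_ne_zero
        have hd := d.val_ne_zero
        simp only [signedRefl_apply_val, SignedIndex.val_pos, SignedIndex.val_neg] at hlt
        simp only [Subtype.ext_iff, SignedIndex.val_pos, SignedIndex.val_neg]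
        split_ifs at hlt <;> omega)
    have e : signedRefl (SignedIndex.pos i) (-SignedIndex.pos i) =
        signedRefl (-SignedIndex.pos i) (SignedIndex.pos i) := by
      apply Subtype.ext
      apply Equiv.ext
      intro c
      apply Subtype.ext
      have hc := c.val_ne_zero
      change ((signedRefl _ _).1 c).1 = ((signedRefl _ _).1 c).1
      simp only [signedRefl_apply_val, SignedIndex.val_pos, SignedIndex.val_neg]
      split_ifs <;> omega
    rw [e]
    rw [signedPerm_apply_neg, SignedIndex.val_neg] at h
    unfold entry
    omega
  · simp only [if_neg hi]
    exact invStat_mul_adj 2 σ i hi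

theorem invStat_mul_genD {n : ℕ} (hn : 2 ≤ n) (σ : signedPerm n) (i : Fin n) :
    (¬IsDescentD (entry σ) i ∧ invStat 0 (σ * genD n i) = invStat 0 σ + 2) ∨
    (IsDescentD (entry σ) i ∧ invStat 0 σ = invStat 0 (σ * genD n i) + 2) := by
  unfold IsDescentD genD
  by_cases hi : (i : ℕ) = 0
  · have h1n : 1 < n := hn
    have hE : (∃ h : 1 < n, entry σ i + entry σ ⟨1, h⟩ < 0) ↔ entry σ i + entry σ ⟨1, h1n⟩ < 0 :=
      ⟨fun ⟨_, h⟩ => h, fun h => ⟨_, h⟩⟩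
    simp only [if_pos hi, dif_pos h1n, hE]
    have h := invStat_mul_signedRefl_cases 0 σ (-SignedIndex.pos ⟨1, h1n⟩) (SignedIndex.pos i)
      (by simp only [SignedIndex.val_pos, SignedIndex.val_neg]; omega)
      (fun h => by
        have := congrArg Subtype.val h
        simp only [SignedIndex.val_pos, SignedIndex.val_neg] at this
        omega)
      (fun c d h0 hcd hlt => by
        have hc := c.val_ne_zero
        have hd := d.val_ne_zero
        -- The generator also reverses `(-1, 1)` and `(-2, 2)`; these pairs have weight 0 and may be
        -- left out.
        have h0' : c.1 ≠ -d.1 := fun h => h0 (Subtype.ext h) rfl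
        simp only [signedRefl_apply_val, SignedIndex.val_pos, SignedIndex.val_neg] at hlt
        simp only [Subtype.ext_iff, SignedIndex.val_pos, SignedIndex.val_neg]
        split_ifs at hlt <;> omega)
    have e : signedRefl (SignedIndex.pos i) (-SignedIndex.pos ⟨1, h1n⟩) =
        signedRefl (-SignedIndex.pos ⟨1, h1n⟩) (SignedIndex.pos i) := by
      apply Subtype.ext
      apply Equiv.ext
      intro c
      apply Subtype.ext
      have hc := c.val_ne_zero
      change ((signedRefl _ _).1 c).1 = ((signedRefl _ _).1 c).1
      simp only [signedRefl_apply_val, SignedIndex.val_pos, SignedIndex.val_neg]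
      split_ifs <;> omega
    rw [e]
    rw [signedPerm_apply_neg, SignedIndex.val_neg] at h
    unfold entry
    omega
  · simp only [if_neg hi]
    exact invStat_mul_adj 0 σ i hi

/-- A squeeze: increasing positive integers give entry `i` at least `i + 1` counting from the left,
and the bound `n` gives at most `i + 1` counting from the right. -/
theorem eq_one_of_entry_strictMono {n : ℕ} (σ : signedPerm n) (hm : StrictMono (entry σ))
    (h0 : ∀ i, 0 < entry σ i) : σ = 1 := by
  apply signedPerm_ext
  intro i
  have hlow : ∀ k (hk : k < n), (k : ℤ) + 1 ≤ entry σ ⟨k, hk⟩ := by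
    intro k
    induction k with
    | zero => intro hk; have := h0 ⟨0, hk⟩; simp only [Nat.cast_zero]; omega
    | succ k ih =>
      intro hk
      have h1 := ih (by omega)
      have h2 := hm (show (⟨k, by omega⟩ : Fin n) < ⟨k + 1, hk⟩ from Nat.lt_succ_self k)
      push_cast
      omega
  have hup : ∀ k (hk : n - 1 - k < n), entry σ ⟨n - 1 - k, hk⟩ ≤ (n - 1 - k : ℕ) + 1 := by
    intro k
    induction k with
    | zero =>
      intro hk
      have := (σ.1 (SignedIndex.pos ⟨n - 1 - 0, hk⟩)).val_le
      change (entry σ _) ≤ _ at this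
      omega
    | succ k ih =>
      intro hk
      have h1 := ih (by omega)
      by_cases hlt : n - 1 - (k + 1) < n - 1 - k
      · have h2 := hm (show (⟨n - 1 - (k + 1), hk⟩ : Fin n) < ⟨n - 1 - k, by omega⟩ from hlt)
        omega
      · have e : n - 1 - (k + 1) = n - 1 - k := by omega
        simp only [e]
        exact h1
  have h1 := hlow i i.2
  have h2 := hup (n - 1 - i) (by omega)
  have e : n - 1 - (n - 1 - (i : ℕ)) = i := by omega
  simp only [e] at h2
  change entry σ i = (i : ℤ) + 1
  simp only [Fin.eta] at h1 h2
  omega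

theorem entry_injective {n : ℕ} (σ : signedPerm n) : Function.Injective (entry σ) := by
  intro i j h
  have := congrArg Subtype.val (σ.1.injective (Subtype.ext h))
  simp only [SignedIndex.val_pos] at this
  exact Fin.ext (by omega)

theorem entry_ne_zero {n : ℕ} (σ : signedPerm n) (i : Fin n) : entry σ i ≠ 0 :=
  SignedIndex.val_ne_zero _

theorem entry_strictMono {n : ℕ} (σ : signedPerm n)
    (h : ∀ i : Fin n, (i : ℕ) ≠ 0 → ¬IsAdjDescent (entry σ) i) : StrictMono (entry σ) := by
  rcases n with _ | n
  · intro i; exact i.elim0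
  · refine Fin.strictMono_iff_lt_succ.2 fun i => ?_
    have h1 := h i.succ (by simp)
    have h2 : entry σ i.castSucc ≠ entry σ i.succ := fun e => by
      have := congrArg Fin.val (entry_injective σ e)
      simp at this
    exact lt_of_le_of_ne (not_lt.1 h1) h2

/-- The length is half of `invStat 2`, and this statistic drops exactly at the descents of the word;
a word without descents is positive and increasing, hence the identity, as the length criterion
requires. -/
theorem des_genB_eq {n : ℕ} [∀ w : Fin n → ℤ, DecidablePred (IsDescentB w)] (σ : signedPerm n) :
    des (genB n) σ = (Finset.univ.filter (IsDescentB (entry σ))).card := by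
  classical
  unfold des
  congr 1
  ext i
  simp only [Finset.mem_filter, Finset.mem_univ, true_and]
  rw [wordLength_mul_lt_iff (genB n) (fun _ => True) (invStat 2) genB_mul_self (invStat_one 2)
    _ trivial (fun _ _ _ => trivial) _ σ trivial i]
  · rcases invStat_mul_genB σ i with ⟨h1, h2⟩ | ⟨h1, h2⟩
    · exact iff_of_false (by omega) h1
    · exact iff_of_true (by omega) h1
  · intro g i _
    rcases invStat_mul_genB g i with ⟨h1, h2⟩ | ⟨h1, h2⟩
    · exact Or.inl h2
    · exact Or.inr h2
  · intro g _ hg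
    by_contra! hcon
    have hnd : ∀ i, ¬IsDescentB (entry g) i := fun i hi => by
      have h3 := hcon i
      rcases invStat_mul_genB g i with ⟨h1, h2⟩ | ⟨h1, h2⟩
      · exact h1 hi
      · omega
    apply hg
    have hm : StrictMono (entry g) := entry_strictMono g fun i hi => by
      have := hnd i
      rwa [IsDescentB, if_neg hi] at this
    refine eq_one_of_entry_strictMono g hm fun i => ?_
    have h0 := hnd ⟨0, i.pos⟩
    rw [IsDescentB, if_pos rfl] at h0
    have h1 : entry g ⟨0, i.pos⟩ ≤ entry g i := hm.monotone (Fin.mk_le_of_le_val (Nat.zero_le _))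
    have h2 := entry_ne_zero g ⟨0, i.pos⟩
    omega

theorem isEvenSigned_iff {n : ℕ} (σ : signedPerm n) :
    IsEvenSigned σ ↔ Even (∑ i : Fin n, if entry σ i < 0 then 1 else 0) := by
  unfold IsEvenSigned
  rw [Finset.card_filter]

theorem IsEvenSigned.mul_genD {n : ℕ} {σ : signedPerm n} (hσ : IsEvenSigned σ) (i : Fin n) :
    IsEvenSigned (σ * genD n i) := by
  rw [isEvenSigned_iff] at hσ ⊢
  by_cases hi : (i : ℕ) = 0
  · by_cases h1n : 1 < n
    · obtain ⟨m, rfl⟩ : ∃ m, n = m + 2 := ⟨n - 2, by omega⟩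
      have hi' : i = 0 := Fin.ext hi
      have hent : ∀ j : Fin (m + 2), entry (σ * genD (m + 2) i) j =
          if j = 0 then -entry σ 1 else if j = 1 then -entry σ 0 else entry σ j := by
        intro j
        change (σ.1 ((genD (m + 2) i).1 (SignedIndex.pos j))).1 = _
        have e : (genD (m + 2) i).1 (SignedIndex.pos j) = if j = 0 then -SignedIndex.pos 1
            else if j = 1 then -SignedIndex.pos 0 else SignedIndex.pos j := by
          apply Subtype.ext
          rw [genD, if_pos hi, dif_pos h1n, signedRefl_apply_val, hi']
          have e1 : (⟨1, h1n⟩ : Fin (m + 2)) = 1 := rfl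
          simp only [e1, SignedIndex.val_pos, SignedIndex.val_neg, Fin.ext_iff, Fin.val_zero,
            Fin.val_one]
          split_ifs <;> simp only [SignedIndex.val_pos, SignedIndex.val_neg, Fin.val_zero,
            Fin.val_one] <;> omega
        rw [e]
        split_ifs
        · rw [signedPerm_apply_neg]; rfl
        · rw [signedPerm_apply_neg]; rfl
        · rfl
      rw [Fin.sum_univ_succ, Fin.sum_univ_succ] at hσ ⊢
      simp only [hent]
      have e1 : ∀ j : Fin m, j.succ.succ ≠ (1 : Fin (m + 2)) := fun j h => by
        simpa using congrArg Fin.val h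
      simp only [if_pos, if_neg (Fin.succ_ne_zero _), if_neg (e1 _), Fin.succ_zero_eq_one,
        one_ne_zero, if_false] at hσ ⊢
      have h0 := entry_ne_zero σ 0
      have h1 := entry_ne_zero σ 1
      rw [Nat.even_iff] at hσ ⊢
      have key : ∀ (a b : ℤ) (S : ℕ), a ≠ 0 → b ≠ 0 →
          ((if a < 0 then 1 else 0) + ((if b < 0 then 1 else 0) + S)) % 2 = 0 →
          ((if -b < 0 then 1 else 0) + ((if -a < 0 then 1 else 0) + S)) % 2 = 0 := by
        intro a b S ha hb h
        split_ifs at h ⊢ <;> omega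
      exact key _ _ _ h0 h1 hσ
    · rwa [genD, if_pos hi, dif_neg h1n, mul_one]
  · rw [← Equiv.sum_comp (Equiv.swap ⟨(i : ℕ) - 1, by omega⟩ i)] at hσ
    have he : ∀ j, entry (σ * genD n i) j =
        entry σ (Equiv.swap ⟨(i : ℕ) - 1, by omega⟩ i j) := by
      intro j
      refine congrArg (fun k => (σ.1 k).1) (Subtype.ext ?_)
      rw [genD, if_neg hi, signedRefl_apply_val]
      have hsw : ((Equiv.swap (⟨(i : ℕ) - 1, by omega⟩ : Fin n) i j : Fin n) : ℕ) =
          if (j : ℕ) = i - 1 then (i : ℕ) else if (j : ℕ) = i then i - 1 else j := by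
        simp only [Equiv.swap_apply_def, Fin.ext_iff]
        split_ifs <;> rfl
      simp only [SignedIndex.val_pos]
      split_ifs at hsw <;> rw [hsw] <;> split_ifs <;> omega
    simp only [he]
    exact hσ

theorem des_genD_eq {n : ℕ} (hn : 2 ≤ n) [∀ w : Fin n → ℤ, DecidablePred (IsDescentD w)]
    (σ : signedPerm n) (hσ : IsEvenSigned σ) :
    des (genD n) σ = (Finset.univ.filter (IsDescentD (entry σ))).card := by
  classical
  unfold des
  congr 1
  ext i
  simp only [Finset.mem_filter, Finset.mem_univ, true_and]
  rw [wordLength_mul_lt_iff (genD n) IsEvenSigned (invStat 0) genD_mul_self (invStat_one 0)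
    _ _ (fun g i hg => hg.mul_genD i) _ σ hσ i]
  · rcases invStat_mul_genD hn σ i with ⟨h1, h2⟩ | ⟨h1, h2⟩
    · exact iff_of_false (by omega) h1
    · exact iff_of_true (by omega) h1
  · intro g i _
    rcases invStat_mul_genD hn g i with ⟨h1, h2⟩ | ⟨h1, h2⟩
    · exact Or.inl h2
    · exact Or.inr h2
  · rw [isEvenSigned_iff, Finset.sum_eq_zero]
    · exact Even.zero
    · intro j _
      refine if_neg (not_lt.2 ?_)
      change 0 ≤ (j : ℤ) + 1
      omega
  · intro g hev hg
    by_contra! hcon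
    have hnd : ∀ i, ¬IsDescentD (entry g) i := fun i hi => by
      have h3 := hcon i
      rcases invStat_mul_genD hn g i with ⟨h1, h2⟩ | ⟨h1, h2⟩
      · exact h1 hi
      · omega
    apply hg
    have hm : StrictMono (entry g) := entry_strictMono g fun i hi => by
      have := hnd i
      rwa [IsDescentD, if_neg hi] at this
    have h0 := hnd ⟨0, by omega⟩
    rw [IsDescentD, if_pos rfl] at h0
    push Not at h0
    have h0' := h0 hn
    have h01 : entry g ⟨0, by omega⟩ < entry g ⟨1, hn⟩ := hm (Fin.mk_lt_mk.2 Nat.zero_lt_one)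
    have hpos : ∀ i : Fin n, 1 ≤ (i : ℕ) → 0 < entry g i := fun i hi => by
      have h1 : entry g ⟨1, hn⟩ ≤ entry g i := hm.monotone (Fin.mk_le_of_le_val hi)
      omega
    -- Without type D descents only the first entry can be negative, and evenness forbids a single
    -- negative entry.
    have hfirst : 0 < entry g ⟨0, by omega⟩ := by
      by_contra hneg
      have hne := entry_ne_zero g ⟨0, by omega⟩
      rw [isEvenSigned_iff, Finset.sum_eq_single (⟨0, by omega⟩ : Fin n)] at hev
      · rw [if_pos (by omega)] at hev
        exact absurd hev (by decide)
      · intro j _ hj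
        refine if_neg (not_lt.2 (hpos j ?_).le)
        have h1 : (j : ℕ) ≠ 0 := fun h => hj (Fin.ext h)
        omega
      · simp
    refine eq_one_of_entry_strictMono g hm fun i => ?_
    by_cases hi : (i : ℕ) = 0
    · have : i = ⟨0, by omega⟩ := Fin.ext hi
      rwa [this]
    · exact hpos i (by omega)

/-! ### Signed permutations as pairs of a permutation and a sign pattern -/

/-- The `i`-th letter of the signed word with absolute values `π i + 1` and sign pattern `ε`
(`true` for negative). -/
def wordVal {n : ℕ} (π : Equiv.Perm (Fin n)) (ε : Fin n → Bool) (i : Fin n) : ℤ :=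
  if ε i then -((π i : ℤ) + 1) else (π i : ℤ) + 1

theorem natAbs_wordVal {n : ℕ} (π : Equiv.Perm (Fin n)) (ε : Fin n → Bool) (i : Fin n) :
    (wordVal π ε i).natAbs = π i + 1 := by
  unfold wordVal
  split_ifs <;> omega

theorem wordVal_neg_iff {n : ℕ} (π : Equiv.Perm (Fin n)) (ε : Fin n → Bool) (i : Fin n) :
    wordVal π ε i < 0 ↔ ε i = true := by
  unfold wordVal
  split_ifs with h <;> simp only [h] <;> constructor <;> intro h <;> first | omega | simp_all

theorem wordVal_ne_zero {n : ℕ} (π : Equiv.Perm (Fin n)) (ε : Fin n → Bool) (i : Fin n) :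
    wordVal π ε i ≠ 0 := by
  have := natAbs_wordVal π ε i
  omega

theorem wordVal_not {n : ℕ} (π : Equiv.Perm (Fin n)) (ε : Fin n → Bool) (i : Fin n) :
    wordVal π (fun j => !ε j) i = -wordVal π ε i := by
  unfold wordVal
  cases h : ε i <;> simp [h, add_comm]

theorem natAbs_wordVal_inj {n : ℕ} (π : Equiv.Perm (Fin n)) (ε : Fin n → Bool) {i j : Fin n}
    (h : (wordVal π ε i).natAbs = (wordVal π ε j).natAbs) : i = j := by
  rw [natAbs_wordVal, natAbs_wordVal] at h
  exact π.injective (Fin.ext (by omega))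

namespace SignedIndex

/-- The element of `±[n]` with given absolute value and sign. -/
def ofSign {n : ℕ} (q : Fin n × Bool) : SignedIndex n := if q.2 then -pos q.1 else pos q.1

theorem ofSign_bijective (n : ℕ) : Function.Bijective (@ofSign n) := by
  constructor
  · rintro ⟨i, b⟩ ⟨j, c⟩ h
    have := congrArg Subtype.val h
    unfold ofSign at this
    cases b <;> cases c <;>
      simp only [if_true, if_false, Bool.false_eq_true, val_neg, val_pos] at this <;>
      simp only [Prod.mk.injEq, Fin.ext_iff, reduceCtorEq, and_true, and_false] <;> omega
  · intro k
    have h0 := k.val_ne_zero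
    have h1 := k.val_le
    have h2 := k.neg_le_val
    refine ⟨(⟨k.1.natAbs - 1, by omega⟩, decide (k.1 < 0)), Subtype.ext ?_⟩
    unfold ofSign
    by_cases h : k.1 < 0
    · simp only [h, decide_true, if_true, val_neg, val_pos]
      omega
    · simp only [h, decide_false, Bool.false_eq_true, if_false, val_pos]
      omega

theorem ofSign_not {n : ℕ} (i : Fin n) (b : Bool) : ofSign (i, !b) = -ofSign (i, b) := by
  cases b <;> simp [ofSign, neg_neg']

end SignedIndex

/-- The signed permutation with a given signed word as one-line notation. -/
noncomputable def wordPerm {n : ℕ} (q : Equiv.Perm (Fin n) × (Fin n → Bool)) : signedPerm n :=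
  let e := Equiv.ofBijective _ (SignedIndex.ofSign_bijective n)
  let f : Fin n × Bool ≃ Fin n × Bool :=
    { toFun := fun p => (q.1 p.1, xor p.2 (q.2 p.1))
      invFun := fun p => (q.1.symm p.1, xor p.2 (q.2 (q.1.symm p.1)))
      left_inv := fun p => by simp
      right_inv := fun p => by simp }
  ⟨(e.symm.trans f).trans e, fun k => by
    obtain ⟨⟨i, b⟩, rfl⟩ := (SignedIndex.ofSign_bijective n).2 k
    have h : ∀ p, e.symm (SignedIndex.ofSign p) = p := fun p => e.symm_apply_apply p
    rw [← SignedIndex.ofSign_not]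
    simp only [Equiv.trans_apply, h]
    change SignedIndex.ofSign (q.1 i, xor (!b) (q.2 i)) = -SignedIndex.ofSign (q.1 i, xor b (q.2 i))
    rw [← SignedIndex.ofSign_not, Bool.not_xor]⟩

theorem entry_wordPerm {n : ℕ} (q : Equiv.Perm (Fin n) × (Fin n → Bool)) (i : Fin n) :
    entry (wordPerm q) i = wordVal q.1 q.2 i := by
  have h : (Equiv.ofBijective _ (SignedIndex.ofSign_bijective n)).symm (SignedIndex.pos i) =
      (i, false) := by
    rw [Equiv.symm_apply_eq]
    rfl
  unfold entry wordPerm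
  simp only [Equiv.trans_apply, h]
  change (SignedIndex.ofSign (q.1 i, xor false (q.2 i))).1 = _
  unfold SignedIndex.ofSign wordVal
  cases q.2 i <;> simp [SignedIndex.val_pos, SignedIndex.val_neg]

theorem wordPerm_bijective (n : ℕ) : Function.Bijective (@wordPerm n) := by
  constructor
  · rintro ⟨π, ε⟩ ⟨ρ, δ⟩ h
    have he : ∀ i, wordVal π ε i = wordVal ρ δ i := fun i => by
      rw [← entry_wordPerm (π, ε), h, entry_wordPerm]
    have h1 : π = ρ := Equiv.ext fun i => by
      have h1 := natAbs_wordVal π ε i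
      have h2 := natAbs_wordVal ρ δ i
      rw [he i] at h1
      exact Fin.ext (by omega)
    have h2 : ε = δ := funext fun i => by
      have h1 := wordVal_neg_iff π ε i
      rw [he i, wordVal_neg_iff] at h1
      exact Bool.eq_iff_iff.2 h1.symm
    rw [h1, h2]
  · intro σ
    have hinj : Function.Injective
        (fun i => (⟨(entry σ i).natAbs - 1, by
          have h1 : entry σ i ≤ n := SignedIndex.val_le _
          have h2 : -(n : ℤ) ≤ entry σ i := SignedIndex.neg_le_val _
          have h3 := i.2
          omega⟩ : Fin n)) := by
      intro i j h
      have h' := congrArg Fin.val h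
      simp only at h'
      have h1 := entry_ne_zero σ i
      have h2 := entry_ne_zero σ j
      have h3 : entry σ i = entry σ j ∨ entry σ i = -entry σ j := by omega
      rcases h3 with h3 | h3
      · exact entry_injective σ h3
      · exfalso
        have h4 : σ.1 (SignedIndex.pos i) = σ.1 (-SignedIndex.pos j) := by
          rw [signedPerm_apply_neg]
          exact Subtype.ext h3
        have := congrArg Subtype.val (σ.1.injective h4)
        simp only [SignedIndex.val_pos, SignedIndex.val_neg] at this
        omega
    refine ⟨(Equiv.ofBijective _ (Finite.injective_iff_bijective.1 hinj),
      fun i => decide (entry σ i < 0)), signedPerm_ext fun i => ?_⟩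
    rw [entry_wordPerm]
    have h1 := entry_ne_zero σ i
    unfold wordVal
    simp only [Equiv.ofBijective_apply, decide_eq_true_eq]
    split_ifs <;> omega

theorem sum_signedPerm {n : ℕ} [Fintype (signedPerm n)] {M : Type*} [AddCommMonoid M]
    (f : signedPerm n → M) :
    ∑ σ, f σ = ∑ π, ∑ ε, f (wordPerm (π, ε)) := by
  rw [← Fintype.sum_prod_type', ← (wordPerm_bijective n).sum_comp]

/-! ### Descents of words and the type B generating polynomials -/

/-- The sequence `0, w₁, …, wₙ`, followed by zeros. -/
def padZero {n : ℕ} (w : Fin n → ℤ) : ℕ → ℤ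
  | 0 => 0
  | j + 1 => if h : j < n then w ⟨j, h⟩ else 0

/-- The number of descents among the first `n + 1` terms of a sequence. -/
def descCount (n : ℕ) (u : ℕ → ℤ) : ℕ := ∑ j ∈ Finset.range n, if u (j + 1) < u j then 1 else 0

/-- The number of descents strictly inside a word. -/
def adjDes {k : ℕ} (w : Fin (k + 1) → ℤ) : ℕ :=
  ∑ i : Fin k, if w i.succ < w i.castSucc then 1 else 0

theorem padZero_val_succ {n : ℕ} (w : Fin n → ℤ) (i : Fin n) : padZero w (i + 1) = w i :=
  dif_pos i.2

theorem padZero_last {k : ℕ} (w : Fin (k + 1) → ℤ) : padZero w (k + 1) = w (Fin.last k) :=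
  padZero_val_succ w (Fin.last k)

theorem card_isDescentB {n : ℕ} (w : Fin n → ℤ) [DecidablePred (IsDescentB w)] :
    (Finset.univ.filter (IsDescentB w)).card = descCount n (padZero w) := by
  unfold descCount
  rw [Finset.card_filter, ← Fin.sum_univ_eq_sum_range
    (fun j => if padZero w (j + 1) < padZero w j then 1 else 0)]
  refine Finset.sum_congr rfl fun i _ => if_congr ?_ rfl rfl
  rw [padZero_val_succ]
  unfold IsDescentB
  split_ifs with h
  · rw [h]; rfl
  · unfold IsAdjDescent
    have e : padZero w i = w ⟨(i : ℕ) - 1, by omega⟩ := by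
      rw [← padZero_val_succ w]
      congr 1
      simp only
      omega
    rw [e]

theorem descCount_padZero {k : ℕ} (w : Fin (k + 1) → ℤ) :
    descCount (k + 1) (padZero w) = (if w 0 < 0 then 1 else 0) + adjDes w := by
  unfold descCount adjDes
  rw [Finset.sum_range_succ', add_comm, ← Fin.sum_univ_eq_sum_range
    (fun j => if padZero w (j + 1 + 1) < padZero w (j + 1) then 1 else 0)]
  congr 1
  refine Finset.sum_congr rfl fun i _ => if_congr ?_ rfl rfl
  rw [← padZero_val_succ w i.succ, ← padZero_val_succ w i.castSucc]
  rfl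

theorem card_isDescentD {k : ℕ} (w : Fin (k + 2) → ℤ) [DecidablePred (IsDescentD w)] :
    (Finset.univ.filter (IsDescentD w)).card = (if w 0 + w 1 < 0 then 1 else 0) + adjDes w := by
  unfold adjDes
  rw [Finset.card_filter, Fin.sum_univ_succ]
  congr 1
  · refine if_congr ?_ rfl rfl
    unfold IsDescentD
    rw [if_pos (Fin.val_zero _)]
    exact ⟨fun ⟨_, h⟩ => h, fun h => ⟨by omega, h⟩⟩
  · refine Finset.sum_congr rfl fun i _ => if_congr ?_ rfl rfl
    unfold IsDescentD
    rw [if_neg (by simp)]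
    rfl

theorem lastPos_iff {k : ℕ} (σ : signedPerm (k + 1)) : LastPos σ ↔ 0 < entry σ (Fin.last k) :=
  ⟨fun h => h _ rfl, fun h i hi => by
    have : i = Fin.last k := Fin.ext (by simpa using hi)
    rwa [this]⟩

open Classical in
/-- The generating polynomial of type `B` descents over signed words whose last letter satisfies
a predicate. -/
noncomputable def lastSumB (Q : ℤ → Prop) (n : ℕ) : ℝ[X] :=
  ∑ π : Equiv.Perm (Fin n), ∑ ε : Fin n → Bool,
    if Q (padZero (wordVal π ε) n) then X ^ descCount n (padZero (wordVal π ε)) else 0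

theorem des_genB_wordPerm {n : ℕ} (π : Equiv.Perm (Fin n)) (ε : Fin n → Bool) :
    des (genB n) (wordPerm (π, ε)) = descCount n (padZero (wordVal π ε)) := by
  classical
  rw [des_genB_eq, card_isDescentB]
  congr 2
  exact funext (entry_wordPerm (π, ε))

theorem eulerianB_eq (n : ℕ) : eulerianB n = lastSumB (fun _ => True) n := by
  classical
  unfold eulerianB lastSumB
  rw [sum_signedPerm]
  simp only [des_genB_wordPerm, if_true]

theorem halfB_eq {n : ℕ} (hn : 1 ≤ n) : halfB n = lastSumB (fun x => 0 < x) n := by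
  obtain ⟨k, rfl⟩ : ∃ k, n = k + 1 := ⟨n - 1, by omega⟩
  classical
  unfold halfB lastSumB
  rw [Finset.sum_filter, sum_signedPerm]
  simp only [des_genB_wordPerm, lastPos_iff, entry_wordPerm, padZero_last]

theorem lastSumB_true {n : ℕ} (hn : 1 ≤ n) :
    lastSumB (fun _ => True) n = lastSumB (fun x => 0 < x) n + lastSumB (fun x => x < 0) n := by
  obtain ⟨k, rfl⟩ : ∃ k, n = k + 1 := ⟨n - 1, by omega⟩
  unfold lastSumB
  rw [← Finset.sum_add_distrib]
  refine Finset.sum_congr rfl fun π _ => ?_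
  rw [← Finset.sum_add_distrib]
  refine Finset.sum_congr rfl fun ε _ => ?_
  have := wordVal_ne_zero π ε (Fin.last k)
  rw [padZero_last, if_pos trivial]
  rcases lt_or_gt_of_ne this with h | h
  · rw [if_neg (by omega), if_pos h, zero_add]
  · rw [if_pos h, if_neg (by omega), add_zero]

theorem padZero_ne_succ {n : ℕ} (π : Equiv.Perm (Fin n)) (ε : Fin n → Bool) {j : ℕ} (hj : j < n) :
    padZero (wordVal π ε) (j + 1) ≠ padZero (wordVal π ε) j := by
  rw [padZero_val_succ _ ⟨j, hj⟩]
  rcases j with _ | j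
  · exact wordVal_ne_zero π ε _
  · rw [padZero_val_succ _ ⟨j, by omega⟩]
    intro h
    have := congrArg Fin.val (natAbs_wordVal_inj π ε (congrArg Int.natAbs h))
    simp at this

theorem padZero_neg {n : ℕ} (w : Fin n → ℤ) (j : ℕ) :
    padZero (fun i => -w i) j = -padZero w j := by
  rcases j with _ | j
  · rfl
  · simp only [padZero]
    split_ifs <;> simp

/-- Consecutive terms of `0, w₁, …, wₙ` are distinct, so negation turns each descent into an ascent
and conversely. This is the source of the symmetry between the two halves. -/
theorem descCount_add_neg {n : ℕ} (π : Equiv.Perm (Fin n)) (ε : Fin n → Bool) :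
    descCount n (padZero (wordVal π fun j => !ε j)) + descCount n (padZero (wordVal π ε)) = n := by
  have e : padZero (wordVal π fun j => !ε j) = fun j => -padZero (wordVal π ε) j := by
    rw [show wordVal π (fun j => !ε j) = fun i => -wordVal π ε i from funext (wordVal_not π ε)]
    exact funext (padZero_neg _)
  unfold descCount
  rw [e, ← Finset.sum_add_distrib]
  trans ∑ j ∈ Finset.range n, 1
  · refine Finset.sum_congr rfl fun j hj => ?_
    have := padZero_ne_succ π ε (Finset.mem_range.1 hj)
    simp only [neg_lt_neg_iff]
    split_ifs <;> omega
  · simp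

/-- Complementing all signs, as a permutation of the sign patterns. -/
def notEquiv (n : ℕ) : (Fin n → Bool) ≃ (Fin n → Bool) :=
  Function.Involutive.toPerm (fun ε j => !ε j) fun ε => by simp

theorem reflect_sum {ι : Type*} (s : Finset ι) (n : ℕ) (f : ι → ℝ[X]) :
    reflect n (∑ i ∈ s, f i) = ∑ i ∈ s, reflect n (f i) := by
  ext k
  simp only [coeff_reflect, finsetSum_coeff]

theorem reflect_X_pow {n d : ℕ} (h : d ≤ n) : reflect n (X ^ d : ℝ[X]) = X ^ (n - d) := by
  rw [reflect_monomial, revAt_le h]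

theorem lastSumB_neg {n : ℕ} (hn : 1 ≤ n) :
    lastSumB (fun x => x < 0) n = reflect n (lastSumB (fun x => 0 < x) n) := by
  obtain ⟨k, rfl⟩ : ∃ k, n = k + 1 := ⟨n - 1, by omega⟩
  unfold lastSumB
  rw [reflect_sum]
  refine Finset.sum_congr rfl fun π _ => ?_
  rw [reflect_sum, ← Equiv.sum_comp (notEquiv (k + 1))]
  refine Finset.sum_congr rfl fun ε _ => ?_
  have h1 : notEquiv (k + 1) ε = fun j => !ε j := rfl
  rw [h1, padZero_last, padZero_last, wordVal_not]
  have h2 := descCount_add_neg π ε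
  by_cases h : 0 < wordVal π ε (Fin.last k)
  · rw [if_pos h, if_pos (by omega), reflect_X_pow (by omega)]
    congr 1
    omega
  · rw [if_neg h, if_neg (by omega), reflect_zero]

/-! ### Inserting a letter and the type B recurrence -/

/-- The permutation that sends `p` to `v` and is order-isomorphic to `π` elsewhere. -/
def insertPerm {n : ℕ} (p v : Fin (n + 1)) (π : Equiv.Perm (Fin n)) : Equiv.Perm (Fin (n + 1)) :=
  (finSuccEquiv' p).trans ((Equiv.optionCongr π).trans (finSuccEquiv' v).symm)

theorem insertPerm_at {n : ℕ} (p v : Fin (n + 1)) (π : Equiv.Perm (Fin n)) :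
    insertPerm p v π p = v := by
  simp [insertPerm]

theorem insertPerm_succAbove {n : ℕ} (p v : Fin (n + 1)) (π : Equiv.Perm (Fin n)) (i : Fin n) :
    insertPerm p v π (p.succAbove i) = v.succAbove (π i) := by
  simp [insertPerm]

theorem insertPerm_injective {n : ℕ} (p v : Fin (n + 1)) :
    Function.Injective (insertPerm p v) := fun π ρ h => Equiv.ext fun i => by
  have := congrArg (fun e : Equiv.Perm _ => e (p.succAbove i)) h
  simp only [insertPerm_succAbove] at this
  exact Fin.succAbove_right_injective this

theorem sum_perm_insert_last {n : ℕ} {M : Type*} [AddCommMonoid M]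
    (f : Equiv.Perm (Fin (n + 1)) → M) :
    ∑ π, f π = ∑ p, ∑ π, f (insertPerm p (Fin.last n) π) := by
  rw [← Fintype.sum_prod_type']
  refine (Function.Bijective.sum_comp ?_ f).symm
  rw [Fintype.bijective_iff_injective_and_card]
  refine ⟨?_, by simp [Fintype.card_perm, Nat.factorial_succ]⟩
  rintro ⟨p, π⟩ ⟨q, ρ⟩ h
  simp only at h
  have hpq : p = q := (insertPerm p (Fin.last n) π).injective
    (by rw [insertPerm_at, h, insertPerm_at])
  subst hpq
  rw [insertPerm_injective _ _ h]

theorem sum_perm_insert_zero {n : ℕ} {M : Type*} [AddCommMonoid M]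
    (f : Equiv.Perm (Fin (n + 1)) → M) :
    ∑ π, f π = ∑ v, ∑ π, f (insertPerm 0 v π) := by
  rw [← Fintype.sum_prod_type']
  refine (Function.Bijective.sum_comp ?_ f).symm
  rw [Fintype.bijective_iff_injective_and_card]
  refine ⟨?_, by simp [Fintype.card_perm, Nat.factorial_succ]⟩
  rintro ⟨p, π⟩ ⟨q, ρ⟩ h
  simp only at h
  have hpq : p = q := by rw [← insertPerm_at 0 p π, h, insertPerm_at]
  subst hpq
  rw [insertPerm_injective _ _ h]

theorem sum_sign_insert {n : ℕ} {M : Type*} [AddCommMonoid M] (p : Fin (n + 1))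
    (f : (Fin (n + 1) → Bool) → M) :
    ∑ ε, f ε = ∑ ε : Fin n → Bool, (f (Fin.insertNth p false ε) + f (Fin.insertNth p true ε)) := by
  rw [← Equiv.sum_comp (Fin.insertNthEquiv (fun _ => Bool) p), Fintype.sum_prod_type_right]
  refine Finset.sum_congr rfl fun ε _ => ?_
  rw [Fintype.sum_bool, add_comm]
  rfl

theorem wordVal_insert_at {n : ℕ} (p : Fin (n + 1)) (π : Equiv.Perm (Fin n)) (b : Bool)
    (ε : Fin n → Bool) :
    wordVal (insertPerm p (Fin.last n) π) (Fin.insertNth p b ε) p =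
      if b then -((n : ℤ) + 1) else (n : ℤ) + 1 := by
  simp [wordVal, insertPerm_at]

theorem wordVal_insert_succAbove {n : ℕ} (p : Fin (n + 1)) (π : Equiv.Perm (Fin n)) (b : Bool)
    (ε : Fin n → Bool) (i : Fin n) :
    wordVal (insertPerm p (Fin.last n) π) (Fin.insertNth p b ε) (p.succAbove i) =
      wordVal π ε i := by
  simp [wordVal, insertPerm_succAbove]

section Insert

variable {n : ℕ} {w : Fin n → ℤ} {w' : Fin (n + 1) → ℤ} {p : Fin (n + 1)}
  (h : ∀ i, w' (p.succAbove i) = w i)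
include h

theorem padZero_insert_of_le {j : ℕ} (hj : j ≤ p) : padZero w' j = padZero w j := by
  rcases j with _ | j
  · rfl
  · have hjn : j < n := by omega
    rw [padZero_val_succ w ⟨j, hjn⟩, ← h, padZero_val_succ w' ⟨j, by omega⟩,
      Fin.succAbove_of_castSucc_lt]
    · rfl
    · exact Fin.lt_def.2 hj

theorem padZero_insert_of_lt {j : ℕ} (hj : p < j) (hjn : j ≤ n) :
    padZero w' (j + 1) = padZero w j := by
  rcases j with _ | j
  · omega
  · rw [padZero_val_succ w ⟨j, hjn⟩, ← h, padZero_val_succ w' ⟨j + 1, by omega⟩,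
      Fin.succAbove_of_le_castSucc]
    · rfl
    · exact Fin.le_def.2 (Nat.lt_succ_iff.1 hj)

theorem descCount_insert_last (hp : p = Fin.last n) :
    descCount (n + 1) (padZero w') = descCount n (padZero w) +
      if w' p < padZero w n then 1 else 0 := by
  have hpv : (p : ℕ) = n := by rw [hp]; rfl
  unfold descCount
  rw [Finset.sum_range_succ]
  congr 1
  · refine Finset.sum_congr rfl fun j hj => ?_
    have := Finset.mem_range.1 hj
    rw [padZero_insert_of_le h (by omega), padZero_insert_of_le h (by omega)]
  · rw [padZero_insert_of_le h hpv.ge, ← padZero_val_succ w' p, hpv]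

/-- A letter larger, or smaller, than both of its neighbours replaces one comparison by two, of
which exactly one is a descent. The count thus stays the same in a descending gap and grows by 1 in
an ascending one. -/
theorem descCount_insert_lt (hp : (p : ℕ) < n)
    (hM : (padZero w p < w' p ∧ padZero w (p + 1) < w' p) ∨
      (w' p < padZero w p ∧ w' p < padZero w (p + 1))) :
    descCount (n + 1) (padZero w') + (if padZero w (p + 1) < padZero w p then 1 else 0) =
      descCount n (padZero w) + 1 := by
  obtain ⟨m, hm⟩ : ∃ m, n = p + 1 + m := ⟨n - (p + 1), by omega⟩
  have e1 : descCount n (padZero w) =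
      ∑ j ∈ Finset.range p, (if padZero w (j + 1) < padZero w j then 1 else 0) +
      (if padZero w (p + 1) < padZero w p then 1 else 0) +
      ∑ j ∈ Finset.range m,
        (if padZero w (p + 1 + j + 1) < padZero w (p + 1 + j) then 1 else 0) := by
    unfold descCount
    rw [show Finset.range n = Finset.range (p + 1 + m) by rw [← hm], Finset.sum_range_add,
      Finset.sum_range_succ]
  have e2 : descCount (n + 1) (padZero w') =
      ∑ j ∈ Finset.range p, (if padZero w' (j + 1) < padZero w' j then 1 else 0) +
      (if padZero w' (p + 1) < padZero w' p then 1 else 0) +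
      (if padZero w' (p + 1 + 1) < padZero w' (p + 1) then 1 else 0) +
      ∑ j ∈ Finset.range m,
        (if padZero w' (p + 1 + 1 + j + 1) < padZero w' (p + 1 + 1 + j) then 1 else 0) := by
    unfold descCount
    rw [show Finset.range (n + 1) = Finset.range (p + 1 + 1 + m) by congr 1; omega,
      Finset.sum_range_add, Finset.sum_range_succ, Finset.sum_range_succ]
  have e3 : ∑ j ∈ Finset.range p, (if padZero w' (j + 1) < padZero w' j then 1 else 0) =
      ∑ j ∈ Finset.range p, (if padZero w (j + 1) < padZero w j then 1 else 0) := by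
    refine Finset.sum_congr rfl fun j hj => ?_
    have := Finset.mem_range.1 hj
    rw [padZero_insert_of_le h (by omega), padZero_insert_of_le h (by omega)]
  have e4 : ∑ j ∈ Finset.range m,
        (if padZero w' (p + 1 + 1 + j + 1) < padZero w' (p + 1 + 1 + j) then 1 else 0) =
      ∑ j ∈ Finset.range m,
        (if padZero w (p + 1 + j + 1) < padZero w (p + 1 + j) then 1 else 0) := by
    refine Finset.sum_congr rfl fun j hj => ?_
    have := Finset.mem_range.1 hj
    rw [show (p : ℕ) + 1 + 1 + j = p + 1 + j + 1 by omega,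
      padZero_insert_of_lt h (by omega) (by omega), padZero_insert_of_lt h (by omega) (by omega)]
  rw [e1, e2, e3, e4, padZero_insert_of_le h le_rfl, padZero_val_succ w' p,
    padZero_insert_of_lt h (Nat.lt_succ_self _) hp]
  rcases hM with ⟨h1, h2⟩ | ⟨h1, h2⟩
  · rw [if_neg (not_lt.2 h1.le), if_pos h2]
    omega
  · rw [if_pos h1, if_neg (not_lt.2 h2.le)]
    omega

end Insert

theorem natAbs_padZero_le {n : ℕ} (π : Equiv.Perm (Fin n)) (ε : Fin n → Bool) (j : ℕ) :
    (padZero (wordVal π ε) j).natAbs ≤ n := by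
  rcases j with _ | j
  · exact Nat.zero_le _
  · simp only [padZero]
    split_ifs with h
    · rw [natAbs_wordVal]
      exact (π _).2
    · exact Nat.zero_le _

/-- The form is affine in the descent indicator of the gap, so that summing over all gaps only needs
the number of descents. -/
theorem X_pow_insert_lt {n : ℕ} (π : Equiv.Perm (Fin n)) (ε : Fin n → Bool) (p : Fin (n + 1))
    (hp : (p : ℕ) < n) (b : Bool) :
    (X : ℝ[X]) ^ descCount (n + 1)
      (padZero (wordVal (insertPerm p (Fin.last n) π) (Fin.insertNth p b ε))) =
    X ^ (descCount n (padZero (wordVal π ε)) + 1) +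
      ((if padZero (wordVal π ε) (p + 1) < padZero (wordVal π ε) p then 1 else 0 : ℕ) : ℝ[X]) *
      (X ^ descCount n (padZero (wordVal π ε)) -
        X ^ (descCount n (padZero (wordVal π ε)) + 1)) := by
  have h1 := natAbs_padZero_le π ε p
  have h2 := natAbs_padZero_le π ε (p + 1)
  have h := descCount_insert_lt (wordVal_insert_succAbove p π b ε) hp (by
    rw [wordVal_insert_at]
    cases b
    · left; simp only [Bool.false_eq_true, if_false]; omega
    · right; simp only [if_true]; omega)
  split_ifs at h ⊢
  · rw [Nat.cast_one, show descCount (n + 1) _ = descCount n (padZero (wordVal π ε)) by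
      exact Nat.add_right_cancel h]
    ring
  · rw [Nat.cast_zero, show descCount (n + 1) _ = descCount n (padZero (wordVal π ε)) + 1 by
      exact h]
    ring

theorem padZero_insert_end_of_lt {n : ℕ} (π : Equiv.Perm (Fin n)) (ε : Fin n → Bool)
    (p : Fin (n + 1)) (hp : (p : ℕ) < n) (b : Bool) :
    padZero (wordVal (insertPerm p (Fin.last n) π) (Fin.insertNth p b ε)) (n + 1) =
      padZero (wordVal π ε) n :=
  padZero_insert_of_lt (wordVal_insert_succAbove p π b ε) hp le_rfl

-- Each word of length `n + 1` arises by inserting `±(n + 1)` into one of length `n`. For a word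
-- with `d` descents, the `n` slots before the end preserve the last letter for `n ≥ 1` and
-- contribute n x^(d+1) + d (x^d - x^(d+1)) for each sign, which is the operator n x + x(1-x) d/dx
-- applied to x^d. The slot at the end makes `±(n + 1)` the last letter and forgets the old one,
-- hence the sum over all words, with a factor `X` for the new descent if the sign is negative.
open Classical in
theorem lastSumB_succ (Q : ℤ → Prop) (n : ℕ) :
    lastSumB Q (n + 1) = 2 * (n : ℝ[X]) * X * lastSumB Q n +
      2 * X * (1 - X) * derivative (lastSumB Q n) +
      ((if Q (n + 1) then 1 else 0) + (if Q (-(n + 1)) then X else 0)) *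
        lastSumB (fun _ => True) n := by
  have key : ∀ (π : Equiv.Perm (Fin n)) (ε : Fin n → Bool),
      (∑ p : Fin (n + 1), ∑ b : Bool,
        if Q (padZero (wordVal (insertPerm p (Fin.last n) π) (Fin.insertNth p b ε)) (n + 1))
        then (X : ℝ[X]) ^ descCount (n + 1)
          (padZero (wordVal (insertPerm p (Fin.last n) π) (Fin.insertNth p b ε))) else 0) =
      2 * (n : ℝ[X]) * X * (if Q (padZero (wordVal π ε) n) then
        X ^ descCount n (padZero (wordVal π ε)) else 0) +
      2 * X * (1 - X) * derivative (if Q (padZero (wordVal π ε) n) then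
        X ^ descCount n (padZero (wordVal π ε)) else 0) +
      ((if Q (n + 1) then 1 else 0) + (if Q (-(n + 1)) then X else 0)) *
        (if True then X ^ descCount n (padZero (wordVal π ε)) else 0) := by
    intro π ε
    rw [Fin.sum_univ_castSucc]
    congr 1
    · set d := descCount n (padZero (wordVal π ε)) with hd
      have e1 : ∀ (j : Fin n) (b : Bool),
          (if Q (padZero (wordVal (insertPerm j.castSucc (Fin.last n) π)
            (Fin.insertNth j.castSucc b ε)) (n + 1))
          then (X : ℝ[X]) ^ descCount (n + 1) (padZero (wordVal
            (insertPerm j.castSucc (Fin.last n) π) (Fin.insertNth j.castSucc b ε))) else 0) =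
          if Q (padZero (wordVal π ε) n) then X ^ (d + 1) +
            ((if padZero (wordVal π ε) (j + 1) < padZero (wordVal π ε) j then 1 else 0 : ℕ) :
              ℝ[X]) * (X ^ d - X ^ (d + 1)) else 0 := by
        intro j b
        rw [padZero_insert_end_of_lt π ε j.castSucc j.2, X_pow_insert_lt π ε j.castSucc j.2]
        rfl
      simp only [e1, Fintype.sum_bool]
      by_cases hQ : Q (padZero (wordVal π ε) n)
      · simp only [if_pos hQ]
        have e2 : ∑ j : Fin n, ((if padZero (wordVal π ε) (j + 1) < padZero (wordVal π ε) j
            then 1 else 0 : ℕ) : ℝ[X]) = d := by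
          rw [hd, descCount, ← Nat.cast_sum]
          congr 1
          exact Fin.sum_univ_eq_sum_range
            (fun j => if padZero (wordVal π ε) (j + 1) < padZero (wordVal π ε) j then 1 else 0) n
        simp only [← two_mul, ← Finset.mul_sum, Finset.sum_add_distrib, ← Finset.sum_mul, e2]
        rw [Finset.sum_const, Finset.card_univ, Fintype.card_fin, nsmul_eq_mul, derivative_X_pow]
        -- The derivative carries the truncated exponent `d - 1`.
        rcases d with _ | d
        · simp; ring
        · simp only [Nat.add_sub_cancel, C_eq_natCast]
          push_cast
          ring
      · simp [if_neg hQ]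
    · rw [Fintype.sum_bool]
      have h1 := natAbs_padZero_le π ε n
      have e1 : ∀ b, padZero (wordVal (insertPerm (Fin.last n) (Fin.last n) π)
          (Fin.insertNth (Fin.last n) b ε)) (n + 1) =
          if b then -((n : ℤ) + 1) else (n : ℤ) + 1 := fun b => by
        rw [padZero_last, wordVal_insert_at]
      simp only [e1, descCount_insert_last (wordVal_insert_succAbove (Fin.last n) π _ ε) rfl,
        wordVal_insert_at, if_true, Bool.false_eq_true, if_false]
      rw [if_pos (show -((n : ℤ) + 1) < _ by omega), if_neg (show ¬ (n : ℤ) + 1 < _ by omega)]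
      split_ifs <;> ring
  have e : lastSumB Q (n + 1) = ∑ π : Equiv.Perm (Fin n), ∑ ε : Fin n → Bool,
      ∑ p : Fin (n + 1), ∑ b : Bool,
        if Q (padZero (wordVal (insertPerm p (Fin.last n) π) (Fin.insertNth p b ε)) (n + 1))
        then (X : ℝ[X]) ^ descCount (n + 1)
          (padZero (wordVal (insertPerm p (Fin.last n) π) (Fin.insertNth p b ε))) else 0 := by
    unfold lastSumB
    rw [sum_perm_insert_last, Finset.sum_comm]
    refine Finset.sum_congr rfl fun π _ => ?_
    rw [Finset.sum_comm (γ := Fin n → Bool)]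
    refine Finset.sum_congr rfl fun p _ => ?_
    rw [sum_sign_insert p]
    refine Finset.sum_congr rfl fun ε _ => ?_
    rw [Fintype.sum_bool, add_comm]
  rw [e]
  simp only [key]
  unfold lastSumB
  simp only [Finset.sum_add_distrib, ← Finset.mul_sum, derivative_sum, if_true]

theorem lastSumB_zero_of_not {Q : ℤ → Prop} (hQ : ¬Q 0) : lastSumB Q 0 = 0 := by
  unfold lastSumB
  refine Finset.sum_eq_zero fun π _ => Finset.sum_eq_zero fun ε _ => if_neg hQ

theorem lastSumB_true_zero : lastSumB (fun _ => True) 0 = 1 := by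
  unfold lastSumB
  simp [descCount]

theorem lastSumB_pos_succ (n : ℕ) :
    lastSumB (fun x => 0 < x) (n + 1) = 2 * (n : ℝ[X]) * X * lastSumB (fun x => 0 < x) n +
      2 * X * (1 - X) * derivative (lastSumB (fun x => 0 < x) n) +
      lastSumB (fun _ => True) n := by
  classical
  rw [lastSumB_succ, if_pos (by omega), if_neg (by omega), add_zero, one_mul]

theorem lastSumB_neg_succ (n : ℕ) :
    lastSumB (fun x => x < 0) (n + 1) = 2 * (n : ℝ[X]) * X * lastSumB (fun x => x < 0) n +
      2 * X * (1 - X) * derivative (lastSumB (fun x => x < 0) n) +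
      X * lastSumB (fun _ => True) n := by
  classical
  rw [lastSumB_succ, if_neg (by omega), if_pos (by omega), zero_add]

theorem lastSumB_pos_one : lastSumB (fun x => 0 < x) 1 = 1 := by
  rw [← zero_add 1, lastSumB_pos_succ, lastSumB_true_zero, lastSumB_zero_of_not (lt_irrefl _)]
  simp

theorem lastSumB_neg_one : lastSumB (fun x => x < 0) 1 = X := by
  rw [← zero_add 1, lastSumB_neg_succ, lastSumB_true_zero, 
    lastSumB_zero_of_not (Q := fun x => x < 0) (lt_irrefl _)]
  simp

/-! ### Cyclic descents and the reduction of type D to type B -/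

theorem sum_wordVal_comp {n : ℕ} {M : Type*} [AddCommMonoid M] (e : Equiv.Perm (Fin n))
    (f : (Fin n → ℤ) → M) :
    ∑ π, ∑ ε, f (wordVal π ε ∘ e) = ∑ π, ∑ ε, f (wordVal π ε) := by
  refine Eq.trans ?_ (Equiv.sum_comp (Equiv.mulRight e) fun π => ∑ ε, f (wordVal π ε))
  refine Finset.sum_congr rfl fun π _ => ?_
  exact Equiv.sum_comp (e.symm.arrowCongr (Equiv.refl Bool)) fun ε =>
    f (wordVal (Equiv.mulRight e π) ε)

theorem sum_wordVal_neg {n : ℕ} {M : Type*} [AddCommMonoid M] (f : (Fin n → ℤ) → M) :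
    ∑ π, ∑ ε, f (fun i => -wordVal π ε i) = ∑ π, ∑ ε, f (wordVal π ε) := by
  refine Finset.sum_congr rfl fun π _ => ?_
  refine Eq.trans ?_ (Equiv.sum_comp (notEquiv n) fun ε => f (wordVal π ε))
  refine Finset.sum_congr rfl fun ε _ => congrArg f (funext fun i => ?_)
  exact (wordVal_not π ε i).symm

theorem adjDes_neg_rev {k : ℕ} (w : Fin (k + 1) → ℤ) :
    adjDes (fun i => -w (Fin.rev i)) = adjDes w := by
  unfold adjDes
  rw [← Equiv.sum_comp Fin.revPerm]
  refine Finset.sum_congr rfl fun i _ => if_congr ?_ rfl rfl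
  simp only [Fin.revPerm_apply, Fin.rev_succ, Fin.rev_castSucc, Fin.rev_rev, neg_lt_neg_iff]

/-- The number of cyclic descents of a word. -/
def cycDes {k : ℕ} (w : Fin (k + 1) → ℤ) : ℕ :=
  ∑ i : Fin (k + 1), if w (i + 1) < w i then 1 else 0

theorem cycDes_eq {k : ℕ} (w : Fin (k + 1) → ℤ) :
    cycDes w = adjDes w + if w 0 < w (Fin.last k) then 1 else 0 := by
  unfold cycDes adjDes
  rw [Fin.sum_univ_castSucc]
  simp only [Fin.coeSucc_eq_succ, Fin.last_add_one]

theorem cycDes_rotate {k : ℕ} (w : Fin (k + 1) → ℤ) :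
    cycDes (w ∘ Equiv.addRight (1 : Fin (k + 1))) = cycDes w := by
  unfold cycDes
  rw [← Equiv.sum_comp (Equiv.addRight (1 : Fin (k + 1)))
    fun i => if w (i + 1) < w i then 1 else 0]
  rfl

/-- Words ending with a positive letter, counted by interior descents, match words ending with a
negative letter, counted by type `B` descents. -/
theorem sum_adjDes_eq_lastSumB_neg (k : ℕ) :
    ∑ π : Equiv.Perm (Fin (k + 1)), ∑ ε : Fin (k + 1) → Bool,
      (if 0 < wordVal π ε (Fin.last k) then (X : ℝ[X]) ^ (1 + adjDes (wordVal π ε)) else 0) =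
    lastSumB (fun x => x < 0) (k + 1) := by
  -- Negation and reversal together preserve interior descents and turn a positive last letter into
  -- a negative first one.
  have e1 := sum_wordVal_neg (n := k + 1)
    fun w => if 0 < w (Fin.last k) then (X : ℝ[X]) ^ (1 + adjDes w) else 0
  have e2 := sum_wordVal_comp (n := k + 1) Fin.revPerm
    fun w => if 0 < -w (Fin.last k) then (X : ℝ[X]) ^ (1 + adjDes fun i => -w i) else 0
  -- Rotation preserves cyclic descents, so words with negative first letter and words with negative
  -- last letter have the same cyclic descent polynomial.
  have e3 := sum_wordVal_comp (n := k + 1) (Equiv.addRight 1)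
    fun w => if w (Fin.last k) < 0 then (X : ℝ[X]) ^ cycDes w else 0
  rw [← e1, ← e2]
  simp only [cycDes_rotate] at e3
  simp only [Function.comp_apply, Equiv.coe_addRight, Fin.last_add_one,
    Fin.revPerm_apply, Fin.rev_last, adjDes_neg_rev, Left.neg_pos_iff] at e3 ⊢
  unfold lastSumB
  simp only [padZero_last, descCount_padZero]
  -- The difference of the two sides agrees word by word with the difference in `e3`: if both end
  -- letters have the same sign both differences vanish, and if the signs differ the cyclic
  -- comparison of last and first letter supplies exactly the type B descent at the start.
  refine sub_eq_zero.1 (Eq.trans ?_ (sub_eq_zero.2 e3))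
  simp only [← Finset.sum_sub_distrib]
  refine Finset.sum_congr rfl fun π _ => Finset.sum_congr rfl fun ε _ => ?_
  have h0 := wordVal_ne_zero π ε 0
  have h1 := wordVal_ne_zero π ε (Fin.last k)
  rw [cycDes_eq]
  rcases lt_or_gt_of_ne h0 with h0 | h0 <;> rcases lt_or_gt_of_ne h1 with h1 | h1
  · simp [h0, h1]
  · simp [h0, h1.not_gt, h0.trans h1, add_comm]
  · rw [if_neg (by omega), if_pos h1, if_neg (by omega), if_neg (by omega), if_pos h1,
      if_neg (by omega)]
    simp
  · rw [if_neg (by omega), if_neg (by omega), if_neg (by omega), if_neg (by omega)]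

/-- The number of type `D` descents of a word. -/
def desD {k : ℕ} (w : Fin (k + 2) → ℤ) : ℕ := (if w 0 + w 1 < 0 then 1 else 0) + adjDes w

theorem adjDes_succ {k : ℕ} (w : Fin (k + 2) → ℤ) :
    adjDes w = (if w 1 < w 0 then 1 else 0) + adjDes fun i : Fin (k + 1) => w i.succ := by
  unfold adjDes
  rw [Fin.sum_univ_succ]
  rfl

theorem wordVal_insertNth_zero_succ {n : ℕ} (π : Equiv.Perm (Fin (n + 1))) (b c : Bool)
    (ε : Fin n → Bool) (i : Fin n) :
    wordVal π (Fin.insertNth 0 b ε) i.succ = wordVal π (Fin.insertNth 0 c ε) i.succ := by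
  simp [wordVal]

theorem wordVal_insertNth_zero_zero {n : ℕ} (π : Equiv.Perm (Fin (n + 1)))
    (ε : Fin n → Bool) :
    wordVal π (Fin.insertNth 0 true ε) 0 = -wordVal π (Fin.insertNth 0 false ε) 0 := by
  simp [wordVal]

/-- Changing the sign of the first letter exchanges the conditions `w 0 + w 1 < 0` and `w 1 < w 0`.
-/
theorem desD_insertNth_true {k : ℕ} (π : Equiv.Perm (Fin (k + 2))) (ε : Fin (k + 1) → Bool) :
    desD (wordVal π (Fin.insertNth 0 true ε)) = desD (wordVal π (Fin.insertNth 0 false ε)) := by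
  unfold desD
  have h1 : wordVal π (Fin.insertNth 0 true ε) 1 = wordVal π (Fin.insertNth 0 false ε) 1 :=
    wordVal_insertNth_zero_succ π true false ε 0
  rw [adjDes_succ, adjDes_succ, wordVal_insertNth_zero_zero, h1]
  simp only [wordVal_insertNth_zero_succ π true false ε]
  generalize wordVal π (Fin.insertNth 0 false ε) 0 = a
  generalize wordVal π (Fin.insertNth 0 false ε) 1 = b
  split_ifs <;> omega

theorem desD_neg {k : ℕ} (π : Equiv.Perm (Fin (k + 2))) (ε : Fin (k + 2) → Bool) :
    desD (fun i => -wordVal π ε i) + desD (wordVal π ε) = k + 2 := by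
  unfold desD adjDes
  have e : (∑ i : Fin (k + 1), if -wordVal π ε i.succ < -wordVal π ε i.castSucc then 1 else 0) +
      (∑ i : Fin (k + 1), if wordVal π ε i.succ < wordVal π ε i.castSucc then 1 else 0) =
      k + 1 := by
    rw [← Finset.sum_add_distrib]
    trans ∑ i : Fin (k + 1), 1
    · refine Finset.sum_congr rfl fun i _ => ?_
      have : wordVal π ε i.succ ≠ wordVal π ε i.castSucc := fun h => by
        simpa using congrArg Fin.val (natAbs_wordVal_inj π ε (congrArg Int.natAbs h))
      split_ifs <;> omega
    · simp
  have h : (wordVal π ε 0).natAbs ≠ (wordVal π ε 1).natAbs := fun h => by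
    simpa using congrArg Fin.val (natAbs_wordVal_inj π ε h)
  beta_reduce
  split_ifs <;> omega

open Classical in
/-- The generating polynomial of type `D` descents over signed words with positive first letter
whose last letter satisfies a predicate. -/
noncomputable def lastSumD (Q : ℤ → Prop) (k : ℕ) : ℝ[X] :=
  ∑ π : Equiv.Perm (Fin (k + 2)), ∑ ε : Fin (k + 1) → Bool,
    if Q (wordVal π (Fin.insertNth 0 false ε) (Fin.last (k + 1)))
    then X ^ desD (wordVal π (Fin.insertNth 0 false ε)) else 0

theorem isEvenSigned_wordPerm {n : ℕ} (π : Equiv.Perm (Fin n)) (ε : Fin n → Bool) :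
    IsEvenSigned (wordPerm (π, ε)) ↔ Even (∑ i, if ε i then 1 else 0) := by
  rw [isEvenSigned_iff]
  simp only [entry_wordPerm, wordVal_neg_iff]

-- Given the other signs, exactly one sign of the first letter makes the permutation even. Type D
-- descents ignore that sign, so it may be taken positive and the parity condition disappears.
open Classical in
theorem sum_even_eq_lastSumD (Q : ℤ → Prop) (k : ℕ) :
    (∑ σ : signedPerm (k + 2) with IsEvenSigned σ ∧ Q (entry σ (Fin.last (k + 1))),
      (X : ℝ[X]) ^ des (genD (k + 2)) σ) = lastSumD Q k := by
  rw [Finset.sum_filter, sum_signedPerm]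
  unfold lastSumD
  refine Finset.sum_congr rfl fun π _ => ?_
  rw [sum_sign_insert 0]
  refine Finset.sum_congr rfl fun ε _ => ?_
  have hdes : ∀ b, IsEvenSigned (wordPerm (π, Fin.insertNth 0 b ε)) →
      des (genD (k + 2)) (wordPerm (π, Fin.insertNth 0 b ε)) =
      desD (wordVal π (Fin.insertNth 0 false ε)) := by
    intro b hb
    rw [des_genD_eq (by omega) _ hb, card_isDescentD]
    simp only [entry_wordPerm, funext (entry_wordPerm _)]
    cases b
    · rfl
    · exact desD_insertNth_true π ε
  have hlast : ∀ b, entry (wordPerm (π, Fin.insertNth 0 b ε)) (Fin.last (k + 1)) =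
      wordVal π (Fin.insertNth 0 false ε) (Fin.last (k + 1)) := by
    intro b
    rw [entry_wordPerm]
    exact wordVal_insertNth_zero_succ π b false ε (Fin.last k)
  have hev : IsEvenSigned (wordPerm (π, Fin.insertNth 0 true ε)) ↔
      ¬IsEvenSigned (wordPerm (π, Fin.insertNth 0 false ε)) := by
    have hs : ∀ b i, (Fin.insertNth 0 b ε : Fin (k + 2) → Bool) i.succ = ε i := fun b i => by simp
    rw [isEvenSigned_wordPerm, isEvenSigned_wordPerm]
    simp only [Fin.sum_univ_succ (n := k + 1), hs, Fin.insertNth_apply_same, if_true,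
      Bool.false_eq_true, if_false, zero_add,
      add_comm 1, Nat.even_add_one]
  by_cases hQ : Q (wordVal π (Fin.insertNth 0 false ε) (Fin.last (k + 1)))
  · by_cases h : IsEvenSigned (wordPerm (π, Fin.insertNth 0 false ε))
    · rw [if_pos ⟨h, by rwa [hlast]⟩, if_neg fun h' => hev.1 h'.1 h, if_pos hQ, hdes _ h, add_zero]
    · rw [if_neg fun h' => h h'.1, if_pos ⟨hev.2 h, by rwa [hlast]⟩, if_pos hQ,
        hdes _ (hev.2 h), zero_add]
  · rw [if_neg fun h' => hQ (by rw [← hlast]; exact h'.2),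
      if_neg fun h' => hQ (by rw [← hlast]; exact h'.2), if_neg hQ, add_zero]

theorem halfD_eq (k : ℕ) : halfD (k + 2) = lastSumD (fun x => 0 < x) k := by
  rw [← sum_even_eq_lastSumD]
  unfold halfD
  refine Finset.sum_congr ?_ fun _ _ => rfl
  ext σ
  simp only [Finset.mem_filter, lastPos_iff]

theorem eulerianD_eq (k : ℕ) : eulerianD (k + 2) =
    lastSumD (fun x => 0 < x) k + lastSumD (fun x => x < 0) k := by
  classical
  have e : eulerianD (k + 2) = lastSumD (fun _ => True) k := by
    rw [← sum_even_eq_lastSumD]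
    unfold eulerianD
    simp only [and_true]
  rw [e]
  unfold lastSumD
  rw [← Finset.sum_add_distrib]
  refine Finset.sum_congr rfl fun π _ => ?_
  rw [← Finset.sum_add_distrib]
  refine Finset.sum_congr rfl fun ε _ => ?_
  rcases lt_or_gt_of_ne (wordVal_ne_zero π (Fin.insertNth 0 false ε) (Fin.last (k + 1)))
    with h | h
  · rw [if_pos trivial, if_neg (by omega), if_pos h, zero_add]
  · rw [if_pos trivial, if_pos h, if_neg (by omega), add_zero]

theorem lastSumD_neg (k : ℕ) :
    lastSumD (fun x => x < 0) k = reflect (k + 2) (lastSumD (fun x => 0 < x) k) := by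
  unfold lastSumD
  rw [reflect_sum]
  refine Finset.sum_congr rfl fun π _ => ?_
  rw [reflect_sum, ← Equiv.sum_comp (notEquiv (k + 1))]
  refine Finset.sum_congr rfl fun ε _ => ?_
  -- Complementing all signs makes the first letter negative; `desD_insertNth_true` then makes it
  -- positive again.
  have h1 : (Fin.insertNth 0 true (notEquiv (k + 1) ε) : Fin (k + 2) → Bool) =
      fun j => !(Fin.insertNth 0 false ε : Fin (k + 2) → Bool) j := by
    funext j
    refine Fin.cases ?_ (fun i => ?_) j
    · simp
    · simp only [Fin.insertNth_zero', Fin.cons_succ]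
      rfl
  have h2 : wordVal π (Fin.insertNth 0 true (notEquiv (k + 1) ε)) =
      fun j => -wordVal π (Fin.insertNth 0 false ε) j := by
    rw [h1]
    exact funext (wordVal_not π _)
  have h3 : wordVal π (Fin.insertNth 0 false (notEquiv (k + 1) ε)) (Fin.last (k + 1)) =
      -wordVal π (Fin.insertNth 0 false ε) (Fin.last (k + 1)) := by
    rw [← congrFun h2]
    exact wordVal_insertNth_zero_succ π false true _ (Fin.last k)
  have h4 := desD_neg π (Fin.insertNth 0 false ε)
  rw [← desD_insertNth_true, h3, h2]
  by_cases h : 0 < wordVal π (Fin.insertNth 0 false ε) (Fin.last (k + 1))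
  · rw [if_pos h, if_pos (by omega), reflect_X_pow (by omega)]
    congr 1
    omega
  · rw [if_neg h, if_neg (by omega), reflect_zero]

theorem wordVal_lt_iff {n : ℕ} (π : Equiv.Perm (Fin n)) (ε : Fin n → Bool) (v : Fin (n + 1))
    (b : Bool) (i j : Fin n) :
    wordVal (insertPerm 0 v π) (Fin.insertNth 0 b ε) i.succ <
      wordVal (insertPerm 0 v π) (Fin.insertNth 0 b ε) j.succ ↔ wordVal π ε i < wordVal π ε j := by
  have h : ∀ i : Fin n, insertPerm 0 v π i.succ = v.succAbove (π i) := fun i => by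
    rw [← insertPerm_succAbove, Fin.succAbove_zero]
  have h1 : (v.succAbove (π i) : ℕ) < v.succAbove (π j) ↔ (π i : ℕ) < π j :=
    Fin.succAbove_lt_succAbove_iff
  have h2 : (v.succAbove (π j) : ℕ) < v.succAbove (π i) ↔ (π j : ℕ) < π i :=
    Fin.succAbove_lt_succAbove_iff
  unfold wordVal
  rw [h, h, ← Fin.succAbove_zero, Fin.insertNth_apply_succAbove, Fin.insertNth_apply_succAbove]
  split_ifs <;> omega

theorem wordVal_pos_iff {n : ℕ} (π : Equiv.Perm (Fin n)) (ε : Fin n → Bool) (v : Fin (n + 1))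
    (b : Bool) (i : Fin n) :
    0 < wordVal (insertPerm 0 v π) (Fin.insertNth 0 b ε) i.succ ↔ 0 < wordVal π ε i := by
  unfold wordVal
  rw [← Fin.succAbove_zero, Fin.insertNth_apply_succAbove]
  split_ifs <;> omega

/-- `B⁺ₙ = D⁺ₙ + n B⁻ₙ₋₁`. -/
theorem lastSumB_eq_lastSumD_add (k : ℕ) :
    lastSumB (fun x => 0 < x) (k + 2) =
      lastSumD (fun x => 0 < x) k + ((k + 2 : ℕ) : ℝ[X]) * lastSumB (fun x => x < 0) (k + 1) := by
  have e1 : lastSumB (fun x => 0 < x) (k + 2) = lastSumD (fun x => 0 < x) k +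
      ∑ π : Equiv.Perm (Fin (k + 2)), ∑ ε : Fin (k + 1) → Bool,
        if 0 < wordVal π (Fin.insertNth 0 false ε) (Fin.last (k + 1)) then
          (X : ℝ[X]) ^ (1 + adjDes fun i : Fin (k + 1) =>
            wordVal π (Fin.insertNth 0 false ε) i.succ) else 0 := by
    unfold lastSumB lastSumD
    rw [← Finset.sum_add_distrib]
    refine Finset.sum_congr rfl fun π _ => ?_
    rw [← Finset.sum_add_distrib, sum_sign_insert 0]
    refine Finset.sum_congr rfl fun ε _ => ?_
    have hlast : wordVal π (Fin.insertNth 0 true ε) (Fin.last (k + 1)) =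
        wordVal π (Fin.insertNth 0 false ε) (Fin.last (k + 1)) :=
      wordVal_insertNth_zero_succ π true false ε (Fin.last k)
    have hone : wordVal π (Fin.insertNth 0 true ε) 1 = wordVal π (Fin.insertNth 0 false ε) 1 :=
      wordVal_insertNth_zero_succ π true false ε 0
    rw [padZero_last, padZero_last, hlast]
    by_cases h : 0 < wordVal π (Fin.insertNth 0 false ε) (Fin.last (k + 1))
    -- Let the first letter be `a` or `-a` with `a > 0`, the second `b`, and let `r` count the
    -- interior descents after the first letter. The two type B exponents are `desD` and `1 + r`:
    -- both are `1 + r` if `|b| < a`, they are `r` and `1 + r` if `b > a`, and `2 + r` and `1 + r`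
    -- if `b < -a`.
    · simp only [if_pos h]
      rw [descCount_padZero, descCount_padZero, desD, adjDes_succ, adjDes_succ, hone,
        wordVal_insertNth_zero_zero]
      simp only [wordVal_insertNth_zero_succ π true false ε]
      have h0 : 0 < wordVal π (Fin.insertNth 0 false ε) 0 := by
        simp only [wordVal, Fin.insertNth_apply_same, Bool.false_eq_true, if_false]
        omega
      have h1 : (wordVal π (Fin.insertNth 0 false ε) 0).natAbs ≠
          (wordVal π (Fin.insertNth 0 false ε) 1).natAbs := fun h => by
        simpa using congrArg Fin.val (natAbs_wordVal_inj π _ h)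
      generalize wordVal π (Fin.insertNth 0 false ε) 0 = a at h0 h1
      generalize wordVal π (Fin.insertNth 0 false ε) 1 = b at h1
      split_ifs <;> first | omega | ring
    · simp only [if_neg h, add_zero]
  rw [e1, ← sum_adjDes_eq_lastSumB_neg]
  congr 1
  rw [sum_perm_insert_zero]
  -- The remaining term depends only on the word after its first letter, up to order isomorphism;
  -- the `k + 2` absolute values of that letter give the factor.
  have e2 : ∀ (v : Fin (k + 2)) (π : Equiv.Perm (Fin (k + 1))) (ε : Fin (k + 1) → Bool),
      (if 0 < wordVal (insertPerm 0 v π) (Fin.insertNth 0 false ε) (Fin.last (k + 1)) then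
          (X : ℝ[X]) ^ (1 + adjDes fun i : Fin (k + 1) =>
            wordVal (insertPerm 0 v π) (Fin.insertNth 0 false ε) i.succ) else 0) =
      if 0 < wordVal π ε (Fin.last k) then X ^ (1 + adjDes (wordVal π ε)) else 0 := by
    intro v π ε
    rw [← Fin.succ_last]
    simp only [wordVal_pos_iff]
    have : (adjDes fun i : Fin (k + 1) =>
        wordVal (insertPerm 0 v π) (Fin.insertNth 0 false ε) i.succ) = adjDes (wordVal π ε) := by
      unfold adjDes
      simp only [wordVal_lt_iff]
    rw [this]
  simp only [e2]
  rw [Finset.sum_const, Finset.card_univ, Fintype.card_fin, nsmul_eq_mul]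

/-! ### Hurwitz polynomials -/

/-- A real polynomial without zeros in the closed right half-plane. -/
def IsHurwitz (p : ℝ[X]) : Prop := ∀ z : ℂ, 0 ≤ z.re → aeval z p ≠ 0

namespace IsHurwitz

variable {p : ℝ[X]}

theorem re_neg_of_mem_roots (hp : IsHurwitz p) {w : ℂ}
    (hw : w ∈ (p.map (algebraMap ℝ ℂ)).roots) : w.re < 0 := by
  by_contra! h
  exact hp w h (by simpa [aeval_def, eval_map] using (mem_roots'.1 hw).2)

theorem roots_map_ne_zero (h0 : p.natDegree ≠ 0) : (p.map (algebraMap ℝ ℂ)).roots ≠ 0 := by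
  intro h
  have := IsAlgClosed.card_roots_eq_natDegree (p := p.map (algebraMap ℝ ℂ))
  rw [h, natDegree_map] at this
  exact h0 this.symm

/-- The logarithmic derivative is the sum of `1 / (z - w)` over the zeros `w`, and each `z - w` has
positive real part. -/
theorem re_logDeriv_nonneg (hp : IsHurwitz p) {z : ℂ} (hz : 0 ≤ z.re) :
    0 ≤ (aeval z (derivative p) / aeval z p).re ∧
      (p.natDegree ≠ 0 → 0 < (aeval z (derivative p) / aeval z p).re) := by
  have hne : (p.map (algebraMap ℝ ℂ)).eval z ≠ 0 := by
    rw [eval_map_algebraMap]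
    exact hp z hz
  have e := (IsAlgClosed.splits (p.map (algebraMap ℝ ℂ))).eval_derivative_div_eval_of_ne_zero hne
  rw [derivative_map, eval_map_algebraMap, eval_map_algebraMap] at e
  have key : ∀ s : Multiset ℂ, (∀ w ∈ s, w.re < 0) →
      0 ≤ ((s.map fun w => 1 / (z - w)).sum).re ∧
        (s ≠ 0 → 0 < ((s.map fun w => 1 / (z - w)).sum).re) := by
    intro s
    induction s using Multiset.induction_on with
    | empty => simp
    | cons w s ih =>
      intro h
      have h1 := (ih fun v hv => h v (Multiset.mem_cons_of_mem hv)).1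
      have h2 := h w (Multiset.mem_cons_self w s)
      have h3 : 0 < (1 / (z - w)).re := by
        rw [one_div, Complex.inv_re]
        have h4 : 0 < (z - w).re := by rw [Complex.sub_re]; linarith
        refine div_pos h4 (Complex.normSq_pos.2 fun h5 => ?_)
        rw [h5, Complex.zero_re] at h4
        exact lt_irrefl _ h4
      rw [Multiset.map_cons, Multiset.sum_cons, Complex.add_re]
      exact ⟨by linarith, fun _ => by linarith⟩
  have hk := key _ fun w hw => hp.re_neg_of_mem_roots hw
  rw [e]
  exact ⟨hk.1, fun h0 => hk.2 (roots_map_ne_zero h0)⟩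

/-- Real coefficients allow `-z` to be replaced by `-conj z`, the mirror image of `z` in the
imaginary axis, which is closer than `z` to every zero. -/
theorem norm_aeval_neg_lt (hp : IsHurwitz p) (h0 : p.natDegree ≠ 0) {z : ℂ} (hz : 0 < z.re) :
    ‖aeval (-z) p‖ < ‖aeval z p‖ := by
  have e1 : ‖aeval (-z) p‖ = ‖aeval (-(starRingEnd ℂ z)) p‖ := by
    rw [← map_neg, aeval_conj, RCLike.norm_conj]
  have e2 : ∀ x : ℂ, aeval x p = (p.map (algebraMap ℝ ℂ)).leadingCoeff *
      ((p.map (algebraMap ℝ ℂ)).roots.map fun a => x - a).prod := fun x => by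
    rw [← eval_map_algebraMap]
    exact (IsAlgClosed.splits _).eval_eq_prod_roots x
  have hterm : ∀ w : ℂ, w.re < 0 → ‖-(starRingEnd ℂ z) - w‖ < ‖z - w‖ := by
    intro w hw
    rw [Complex.norm_def, Complex.norm_def]
    refine Real.sqrt_lt_sqrt (Complex.normSq_nonneg _) ?_
    rw [Complex.normSq_apply, Complex.normSq_apply]
    simp only [Complex.sub_re, Complex.sub_im, Complex.neg_re, Complex.neg_im, Complex.conj_re,
      Complex.conj_im, neg_neg]
    nlinarith [mul_pos hz (neg_pos.2 hw)]
  have key : ∀ s : Multiset ℂ, (∀ w ∈ s, w.re < 0) → s ≠ 0 →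
      ‖(s.map fun a => -(starRingEnd ℂ z) - a).prod‖ < ‖(s.map fun a => z - a).prod‖ := by
    intro s
    induction s using Multiset.induction_on with
    | empty => simp
    | cons w s ih =>
      intro h _
      have h1 := hterm w (h w (Multiset.mem_cons_self w s))
      simp only [Multiset.map_cons, Multiset.prod_cons, norm_mul]
      by_cases hs : s = 0
      · simpa [hs] using h1
      · exact mul_lt_mul'' h1 (ih (fun v hv => h v (Multiset.mem_cons_of_mem hv)) hs)
          (norm_nonneg _) (norm_nonneg _)
  have hk := key _ (fun w hw => hp.re_neg_of_mem_roots hw) (roots_map_ne_zero h0)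
  rw [e1, e2, e2 z, norm_mul, norm_mul]
  refine mul_lt_mul_of_pos_left hk (norm_pos_iff.2 ?_)
  rw [Ne, leadingCoeff_eq_zero]
  intro h
  rw [Polynomial.map_eq_zero] at h
  exact h0 (by rw [h, natDegree_zero])

end IsHurwitz

/-! ### The Hermite–Biehler theorem -/

section HermiteBiehler

variable {p q : ℝ[X]}

theorem aeval_expand_two_add (z : ℂ) :
    aeval z (expand ℝ 2 p + X * expand ℝ 2 q) = aeval (z ^ 2) p + z * aeval (z ^ 2) q := by
  simp [expand_aeval]

variable (hF : IsHurwitz (expand ℝ 2 p + X * expand ℝ 2 q))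
  (h0 : (expand ℝ 2 p + X * expand ℝ 2 q).natDegree ≠ 0)
include hF h0

/-- With `e` and `o` the even and odd parts at `z`, the inequality `|e - o| < |e + o|` of
`norm_aeval_neg_lt` is exactly this positivity. -/
theorem re_even_mul_conj_odd_pos {z : ℂ} (hz : 0 < z.re) :
    0 < (aeval (z ^ 2) p * starRingEnd ℂ (z * aeval (z ^ 2) q)).re := by
  have h := hF.norm_aeval_neg_lt h0 hz
  rw [aeval_expand_two_add, aeval_expand_two_add, neg_sq] at h
  generalize aeval (z ^ 2) p = e at h ⊢
  rw [neg_mul] at h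
  generalize z * aeval (z ^ 2) q = o at h ⊢
  rw [Complex.norm_def, Complex.norm_def] at h
  have h' := lt_of_not_ge fun h' => (not_lt.2 (Real.sqrt_le_sqrt h')) h
  simp only [Complex.normSq_apply, Complex.add_re, Complex.add_im, Complex.neg_re,
    Complex.neg_im] at h'
  simp only [Complex.mul_re, Complex.conj_re, Complex.conj_im]
  nlinarith

/-- For the third claim, a zero would give `e = -z o`, whence `Re (e * conj o) = -(Re z) |o|² ≤ 0`.
As every nonreal number is the square of some `z` with `Re z > 0`, the real-rootedness statements
below follow. -/
theorem aeval_sq_ne_zero {z : ℂ} (hz : 0 < z.re) :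
    aeval (z ^ 2) p ≠ 0 ∧ aeval (z ^ 2) q ≠ 0 ∧ aeval (z ^ 2) (p + X * q) ≠ 0 := by
  have h := re_even_mul_conj_odd_pos hF h0 hz
  refine ⟨fun e => ?_, fun e => ?_, fun e => ?_⟩
  · simp [e] at h
  · simp [e] at h
  · rw [map_add, map_mul, aeval_X, add_eq_zero_iff_eq_neg, sq, mul_assoc, ← sq] at e
    rw [e] at h
    generalize z * aeval (z ^ 2) q = o at h
    have e2 : (-(z * o) * starRingEnd ℂ o).re = -(z.re * Complex.normSq o) := by
      rw [neg_mul, mul_assoc, Complex.mul_conj, Complex.neg_re, Complex.re_mul_ofReal]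
    rw [e2] at h
    have := mul_nonneg hz.le (Complex.normSq_nonneg o)
    linarith

omit hF h0 in
theorem exists_sq_eq_of_im_ne_zero {w : ℂ} (hw : w.im ≠ 0) : ∃ z : ℂ, 0 < z.re ∧ z ^ 2 = w := by
  obtain ⟨z, hz⟩ := IsAlgClosed.exists_pow_nat_eq w (n := 2) two_pos
  have hre : z.re ≠ 0 := fun h => hw (by rw [← hz, sq, Complex.mul_im, h]; ring)
  rcases lt_or_gt_of_ne hre with h | h
  · exact ⟨-z, by rw [Complex.neg_re]; linarith, by rw [neg_sq, hz]⟩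
  · exact ⟨z, h, hz⟩

theorem hasOnlyRealZeros_even : HasOnlyRealZeros p := by
  refine ⟨fun e => (aeval_sq_ne_zero hF h0 (z := 1) (by simp)).1 (by simp [e]), fun w hw => ?_⟩
  by_contra h
  obtain ⟨z, hz, rfl⟩ := exists_sq_eq_of_im_ne_zero h
  exact (aeval_sq_ne_zero hF h0 hz).1 hw

theorem hasOnlyRealZeros_odd : HasOnlyRealZeros (X * q) := by
  refine ⟨fun e => ?_, fun w hw => ?_⟩
  · refine (aeval_sq_ne_zero hF h0 (z := 1) (by simp)).2.1 ?_
    rw [(mul_eq_zero.1 e).resolve_left X_ne_zero, map_zero]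
  · by_contra h
    obtain ⟨z, hz, rfl⟩ := exists_sq_eq_of_im_ne_zero h
    rw [map_mul, aeval_X] at hw
    rcases mul_eq_zero.1 hw with h1 | h1
    · exact h (by rw [h1, Complex.zero_im])
    · exact (aeval_sq_ne_zero hF h0 hz).2.1 h1

theorem hasOnlyRealZeros_add : HasOnlyRealZeros (p + X * q) := by
  refine ⟨fun e => (aeval_sq_ne_zero hF h0 (z := 1) (by simp)).2.2 (by simp [e]), fun w hw => ?_⟩
  by_contra h
  obtain ⟨z, hz, rfl⟩ := exists_sq_eq_of_im_ne_zero h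
  exact (aeval_sq_ne_zero hF h0 hz).2.2 hw

theorem eval_odd_ne_zero {x : ℝ} (hx : 0 < x) : q.eval x ≠ 0 := by
  have h := (aeval_sq_ne_zero hF h0 (z := (Real.sqrt x : ℂ)) (by simpa using hx)).2.1
  rw [← Complex.ofReal_pow, Real.sq_sqrt hx.le] at h
  intro e
  apply h
  have e2 : aeval (x : ℂ) q = ((q.eval x : ℝ) : ℂ) := aeval_algebraMap_apply_eq_algebraMap_eval x q
  rw [e2, e, Complex.ofReal_zero]

/-- The Wronskian of the real and imaginary parts of a Hurwitz polynomial on the imaginary axis is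
positive. -/
theorem wronskian_pos (y : ℝ) :
    0 < (p.comp (-X ^ 2)).eval y * (derivative (X * q.comp (-X ^ 2))).eval y -
      (derivative (p.comp (-X ^ 2))).eval y * (X * q.comp (-X ^ 2)).eval y := by
  set F := expand ℝ 2 p + X * expand ℝ 2 q with hFdef
  set a := p.comp (-X ^ 2) with ha
  set b := X * q.comp (-X ^ 2) with hb
  -- On the imaginary axis F(iy) = a(y) + i b(y); the positive real part of F'/F there is the
  -- Wronskian a b' - a' b divided by |F|².
  have hpoly : (F.map (algebraMap ℝ ℂ)).comp (C Complex.I * X) =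
      a.map (algebraMap ℝ ℂ) + C Complex.I * b.map (algebraMap ℝ ℂ) := by
    have e : (X ^ 2 : ℂ[X]).comp (C Complex.I * X) = -X ^ 2 := by
      rw [X_pow_comp, mul_pow, ← C_pow, Complex.I_sq]
      simp
    rw [hFdef, ha, hb, expand_eq_comp_X_pow, expand_eq_comp_X_pow]
    simp only [Polynomial.map_add, Polynomial.map_mul, Polynomial.map_comp, Polynomial.map_pow,
      map_X, Polynomial.map_neg, add_comp, mul_comp, comp_assoc, e, X_comp]
    ring
  have hder := congrArg derivative hpoly
  rw [derivative_comp] at hder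
  simp only [derivative_add, derivative_mul, derivative_C, zero_mul, zero_add, derivative_X,
    mul_one, derivative_map] at hder
  have h1 := congrArg (eval (y : ℂ)) hpoly
  have h2 := congrArg (eval (y : ℂ)) hder
  have er : ∀ f : ℝ[X], (f.map (algebraMap ℝ ℂ)).eval (y : ℂ) = ((f.eval y : ℝ) : ℂ) := fun f => by
    rw [eval_map_algebraMap]
    exact aeval_algebraMap_apply_eq_algebraMap_eval y f
  simp only [eval_comp, eval_add, eval_mul, eval_C, eval_X, er, eval_map_algebraMap] at h1 h2
  have hpos := (hF.re_logDeriv_nonneg (z := Complex.I * y) (by simp)).2 h0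
  have hne : aeval (Complex.I * (y : ℂ)) F ≠ 0 := hF _ (by simp)
  generalize eval y a = A at *
  generalize eval y b = B at *
  generalize eval y (derivative a) = A' at *
  generalize eval y (derivative b) = B' at *
  have h3 : aeval (Complex.I * (y : ℂ)) (derivative F) = -Complex.I * (A' + Complex.I * B') := by
    rw [← h2, ← mul_assoc]
    simp
  rw [h3, h1] at hpos
  rw [h1] at hne
  rw [Complex.div_re, ← add_div] at hpos
  have h4 := (div_pos_iff_of_pos_right (Complex.normSq_pos.2 hne)).1 hpos
  simp at h4
  linarith

/-- Put x = -y². If `a` had no zero between consecutive square roots, Rolle's theorem for `b / a`,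
which vanishes at both ends, would produce a zero of the Wronskian. -/
theorem exists_root_even_between {x₁ x₂ : ℝ} (h₁₂ : x₁ < x₂) (hx₂ : x₂ ≤ 0)
    (hr₁ : (X * q).eval x₁ = 0) (hr₂ : (X * q).eval x₂ = 0) :
    ∃ c, x₁ < c ∧ c < x₂ ∧ p.eval c = 0 := by
  set a := p.comp (-X ^ 2) with ha
  set b := X * q.comp (-X ^ 2) with hb
  have hbz : ∀ x, x ≤ 0 → (X * q).eval x = 0 → b.eval (Real.sqrt (-x)) = 0 := by
    intro x hx h
    have hs : -(Real.sqrt (-x) * Real.sqrt (-x)) = x := by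
      rw [Real.mul_self_sqrt (by linarith), neg_neg]
    rw [eval_mul, eval_X] at h
    simp only [hb, eval_mul, eval_X, eval_comp, eval_neg, sq, hs]
    rcases mul_eq_zero.1 h with h | h
    · simp [h]
    · rw [h, mul_zero]
  have hy1 := hbz x₁ (by linarith) hr₁
  have hy2 := hbz x₂ hx₂ hr₂
  have hlt : Real.sqrt (-x₂) < Real.sqrt (-x₁) :=
    Real.sqrt_lt_sqrt (by linarith) (by linarith)
  have hW := wronskian_pos hF h0
  have hne : ∀ y, b.eval y = 0 → a.eval y ≠ 0 := by
    intro y hy h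
    have := hW y
    rw [← ha, ← hb, h, hy] at this
    simp at this
  obtain ⟨y, hy, hay⟩ : ∃ y ∈ Set.Ioo (Real.sqrt (-x₂)) (Real.sqrt (-x₁)), a.eval y = 0 := by
    by_contra! hcon
    have hall : ∀ y ∈ Set.Icc (Real.sqrt (-x₂)) (Real.sqrt (-x₁)), a.eval y ≠ 0 := by
      intro y hy
      rcases eq_or_lt_of_le hy.1 with h | h
      · exact hne y (by rw [← h]; exact hy2)
      rcases eq_or_lt_of_le hy.2 with h' | h'
      · exact hne y (by rw [h']; exact hy1)
      exact hcon y ⟨h, h'⟩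
    obtain ⟨c, hc, hc0⟩ := exists_hasDerivAt_eq_zero (f := fun y => b.eval y / a.eval y)
      (f' := fun y => (b.derivative.eval y * a.eval y - b.eval y * a.derivative.eval y) /
        a.eval y ^ 2) hlt (b.continuous.continuousOn.div a.continuous.continuousOn hall)
      (by simp only [hy1, hy2, zero_div])
      (fun y hy => (b.hasDerivAt y).div (a.hasDerivAt y) (hall y (Set.Ioo_subset_Icc_self hy)))
    have h1 := hall c (Set.Ioo_subset_Icc_self hc)
    rw [div_eq_zero_iff, or_iff_left (pow_ne_zero 2 h1)] at hc0
    have := hW c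
    rw [← ha, ← hb] at this
    linarith
  have hy0 : 0 < y := (Real.sqrt_nonneg _).trans_lt hy.1
  refine ⟨-y ^ 2, ?_, ?_, ?_⟩
  · have := (Real.lt_sqrt hy0.le).1 hy.2
    linarith
  · have := (Real.sqrt_lt' hy0).1 hy.1
    linarith
  · simpa [ha] using hay

/-- At a multiple zero x = -y² both q(x) and x q'(x) vanish. Then so do b(y) = y q(x) and b'(y) =
q(x) + 2x q'(x), against the positive Wronskian. -/
theorem eval_derivative_odd_ne_zero {x : ℝ} (hx : (X * q).eval x = 0) :
    (derivative (X * q)).eval x ≠ 0 := by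
  intro hd
  have hW := wronskian_pos hF h0
  rw [eval_mul, eval_X] at hx
  rw [derivative_mul, derivative_X, one_mul, eval_add, eval_mul, eval_X] at hd
  have hx0 : x ≤ 0 := by
    by_contra! h
    exact (mul_ne_zero h.ne' (eval_odd_ne_zero hF h0 h)) hx
  have hq : q.eval x = 0 := by
    rcases mul_eq_zero.1 hx with h | h
    · simpa [h] using hd
    · exact h
  have hxd : x * q.derivative.eval x = 0 := by rwa [hq, zero_add] at hd
  have hs : -(Real.sqrt (-x) * Real.sqrt (-x)) = x := by
    rw [Real.mul_self_sqrt (by linarith), neg_neg]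
  have := hW (Real.sqrt (-x))
  have e1 : eval (Real.sqrt (-x)) (X * q.comp (-X ^ 2)) = 0 := by
    simp only [eval_mul, eval_X, eval_comp, eval_neg, sq, hs, hq, mul_zero]
  have e2 : eval (Real.sqrt (-x)) (derivative (X * q.comp (-X ^ 2))) = 0 := by
    simp only [derivative_mul, derivative_X, one_mul, derivative_comp, derivative_neg, eval_add,
      eval_mul, eval_X, eval_comp, eval_neg, sq, hs, hq, mul_one, zero_add]
    linear_combination 2 * hxd + 2 * q.derivative.eval x * hs
  rw [e1, e2] at this
  simp at this

end HermiteBiehler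

theorem HasOnlyRealZeros.splits {p : ℝ[X]} (hp : HasOnlyRealZeros p) : p.Splits := by
  refine Splits.of_splits_map (algebraMap ℝ ℂ) (IsAlgClosed.splits _) fun w hw => ?_
  have := hp.2 w (by simpa [aeval_def, eval_map] using (mem_roots'.1 hw).2)
  exact ⟨w.re, Complex.ext (by simp) (by simp [this])⟩

/-- One half of the Hermite–Biehler theorem: the even and odd parts of a Hurwitz polynomial have
interlacing zeros. -/
theorem IsHurwitz.interlaces {p q : ℝ[X]}
    (hF : IsHurwitz (expand ℝ 2 p + X * expand ℝ 2 q)) (hdeg : p.natDegree ≤ q.natDegree)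
    (hp : 0 < p.leadingCoeff) (hq : 0 < q.leadingCoeff) :
    Interlaces p (X * q) ∧ HasOnlyRealZeros (p + X * q) := by
  have h0 : (expand ℝ 2 p + X * expand ℝ 2 q).natDegree ≠ 0 := by
    have : (expand ℝ 2 p + X * expand ℝ 2 q).coeff (2 * q.natDegree + 1) ≠ 0 := by
      rw [coeff_add, coeff_X_mul, coeff_expand two_pos, if_neg (by omega), mul_comm,
        coeff_expand_mul two_pos, zero_add]
      exact hq.ne'
    have := le_natDegree_of_ne_zero this
    omega
  have hXq := hasOnlyRealZeros_odd hF h0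
  have hq0 : q ≠ 0 := fun h => by simp [h] at hq
  have hp0 : p ≠ 0 := fun h => by simp [h] at hp
  refine ⟨⟨hasOnlyRealZeros_even hF h0, hXq, hp, by rwa [leadingCoeff_mul, leadingCoeff_X, one_mul],
    ?_⟩, hasOnlyRealZeros_add hF h0⟩
  set r := (X * q).roots.sort (· ≥ ·) with hr
  have hrm : (r : Multiset ℝ) = (X * q).roots := Multiset.sort_eq _ _
  have hrs : r.Pairwise (· ≥ ·) := Multiset.pairwise_sort _ _
  have hlen : r.length = q.natDegree + 1 := by
    rw [← Multiset.coe_card, hrm, ← hXq.splits.natDegree_eq_card_roots, natDegree_X_mul hq0]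
  have hroot : ∀ x ∈ r, (X * q).eval x = 0 := fun x hx =>
    (mem_roots'.1 (by rw [← hrm]; exact hx)).2
  have hnonpos : ∀ x ∈ r, x ≤ 0 := fun x hx => by
    by_contra! h
    have := hroot x hx
    rw [eval_mul, eval_X] at this
    exact mul_ne_zero h.ne' (eval_odd_ne_zero hF h0 h) this
  have hnd : r.Nodup := by
    rw [← Multiset.coe_nodup, hrm, Multiset.nodup_iff_count_le_one]
    intro x
    rw [count_roots]
    by_contra! h
    rw [one_lt_rootMultiplicity_iff_isRoot hXq.1] at h
    exact eval_derivative_odd_ne_zero hF h0 h.1 h.2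
  have hstrict : r.Pairwise (· > ·) := by
    refine (hrs.and hnd).imp fun h => lt_of_le_of_ne h.1 h.2.symm
  have hlt : ∀ i j (hi : i < r.length) (hj : j < r.length), i < j → r[j] < r[i] :=
    fun i j hi hj hij => List.pairwise_iff_getElem.1 hstrict i j hi hj hij
  -- The `deg q + 1` simple zeros of `X * q` leave `deg q` gaps, each with a zero of `p`; by `hdeg`
  -- these are all the zeros of `p`.
  have hex : ∀ i : Fin q.natDegree, ∃ c, r[(i : ℕ) + 1] < c ∧ c < r[(i : ℕ)] ∧ p.eval c = 0 :=
    fun i => exists_root_even_between hF h0 (hlt _ _ _ _ (Nat.lt_succ_self _))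
      (hnonpos _ (List.getElem_mem _)) (hroot _ (List.getElem_mem _))
      (hroot _ (List.getElem_mem _))
  choose g hg1 hg2 hg3 using hex
  have hgs : ∀ i j, i < j → g j < g i := fun i j hij => by
    have h1 : r[(j : ℕ)] ≤ r[(i : ℕ) + 1] := by
      rcases eq_or_lt_of_le (Nat.succ_le_of_lt (Fin.lt_def.1 hij)) with h | h
      · simp only [← h, Nat.succ_eq_add_one, le_refl]
      · exact (hlt _ _ _ _ h).le
    exact (hg2 j).trans_le (h1.trans (hg1 i).le)
  have hsm : (List.ofFn g : Multiset ℝ) = p.roots := by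
    refine Multiset.eq_of_le_of_card_le ?_ ?_
    · rw [Multiset.le_iff_subset]
      · intro x hx
        obtain ⟨i, rfl⟩ := (List.mem_ofFn' g x).1 hx
        exact (mem_roots hp0).2 (hg3 i)
      · rw [Multiset.coe_nodup, List.nodup_ofFn]
        intro i j h
        by_contra hne
        rcases lt_or_gt_of_ne hne with h' | h'
        · exact (hgs _ _ h').ne' h
        · exact (hgs _ _ h').ne h
    · rw [Multiset.coe_card, List.length_ofFn]
      exact (card_roots' p).trans hdeg
  refine ⟨r, List.ofFn g, hrm, hsm, hrs, ?_, ?_, ?_, ?_⟩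
  · rw [List.pairwise_ofFn]
    exact fun i j hij => (hgs i j hij).le
  · rw [List.length_ofFn]
    exact Or.inr hlen
  · intro i hr hs
    rw [List.getElem_ofFn]
    exact (hg2 _).le
  · intro i hr hs
    rw [List.getElem_ofFn]
    exact (hg1 ⟨i, by simpa using hs⟩).le

/-! ### Self-reciprocal polynomials -/

theorem pow_mul_aeval_inv (n : ℕ) (p : ℝ[X]) (hp : p.natDegree ≤ n) {z : ℂ} (hz : z ≠ 0) :
    z ^ n * aeval z⁻¹ p = aeval z (reflect n p) := by
  let _ : Invertible z⁻¹ := ⟨z, mul_inv_cancel₀ hz, inv_mul_cancel₀ hz⟩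
  have h : aeval z (reflect n p) * z⁻¹ ^ n = aeval z⁻¹ p :=
    eval₂_reflect_mul_pow (algebraMap ℝ ℂ) z⁻¹ n p hp
  rw [← h, mul_comm, mul_assoc, ← mul_pow, inv_mul_cancel₀ hz, one_pow, mul_one]

theorem pow_mul_aeval_inv_reflect (n : ℕ) (p : ℝ[X]) (hp : p.natDegree ≤ n) {z : ℂ}
    (hz : z ≠ 0) : z ^ n * aeval z⁻¹ (reflect n p) = aeval z p := by
  rw [← pow_mul_aeval_inv n p hp (inv_ne_zero hz), inv_inv, ← mul_assoc, ← mul_pow,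
    mul_inv_cancel₀ hz, one_pow, one_mul]

/-- A polynomial with the symmetry `t ↦ 1/t` is Hurwitz as soon as it has no zeros in the closed
right half of the unit disc. -/
theorem isHurwitz_of_symm {n : ℕ} {p G : ℝ[X]} (hp : p.natDegree ≤ n)
    (hG : X * expand ℝ 2 p + expand ℝ 2 (reflect n p) = X * G)
    (hdisc : ∀ z : ℂ, 0 ≤ z.re → ‖z‖ ≤ 1 → aeval z G ≠ 0) : IsHurwitz G := by
  intro z hz
  by_cases h1 : ‖z‖ ≤ 1
  · exact hdisc z hz h1
  have hz0 : z ≠ 0 := fun h => h1 (by simp [h])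
  have hinv : aeval z⁻¹ G ≠ 0 := by
    refine hdisc _ ?_ ?_
    · rw [Complex.inv_re]
      exact div_nonneg hz (Complex.normSq_nonneg z)
    · rw [norm_inv]
      exact inv_le_one_of_one_le₀ (not_le.1 h1).le
  intro h
  apply hinv
  have e : ∀ w : ℂ, w * aeval (w ^ 2) p + aeval (w ^ 2) (reflect n p) = w * aeval w G := fun w => by
    simpa [expand_aeval] using congrArg (aeval w) hG
  have e1 := e z
  have e2 := e z⁻¹
  rw [h, mul_zero] at e1
  rw [inv_pow] at e2
  have h2 := pow_mul_aeval_inv n p hp (pow_ne_zero 2 hz0)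
  have h3 := pow_mul_aeval_inv_reflect n p hp (pow_ne_zero 2 hz0)
  -- The symmetry reads G(z) = z^(2n-1) G(1/z), written with `z⁻¹` to avoid the subtraction in the
  -- exponent; inversion preserves the closed right half-plane apart from 0.
  have h4 : (z ^ 2) ^ n * aeval z⁻¹ G = 0 := by
    have h5 : (z ^ 2) ^ n * (z⁻¹ * aeval (z ^ 2)⁻¹ p + aeval (z ^ 2)⁻¹ (reflect n p)) =
        z⁻¹ * (aeval (z ^ 2) (reflect n p) + z * aeval (z ^ 2) p) := by
      rw [mul_add, mul_left_comm, h2, h3, mul_add, inv_mul_cancel_left₀ hz0]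
    rw [add_comm (aeval (z ^ 2) (reflect n p)), e1, mul_zero, e2] at h5
    rw [mul_left_comm] at h5
    exact (mul_eq_zero.1 h5).resolve_left (inv_ne_zero hz0)
  exact (mul_eq_zero.1 h4).resolve_left (pow_ne_zero _ (pow_ne_zero 2 hz0))

/-- Evaluating `hG` at 0 shows that the reflection is `X * q`, so that `p` and `q` give the even and
odd parts of `G`. It also kills the coefficient `n` of `p`; the constant term 1 of `p` becomes the
leading coefficient of `q`, in degree `n - 1`, which yields the degree condition of
`IsHurwitz.interlaces`. -/
theorem interlaces_reflect_of_isHurwitz {n : ℕ} {p G : ℝ[X]} (hn : 1 ≤ n) (hp : p.natDegree ≤ n)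
    (hG : X * expand ℝ 2 p + expand ℝ 2 (reflect n p) = X * G) (hH : IsHurwitz G)
    (hcoeff : ∀ k, 0 ≤ p.coeff k) (hzero : p.coeff 0 = 1) :
    Interlaces p (reflect n p) ∧ HasOnlyRealZeros (p + reflect n p) := by
  have hr0 : (reflect n p).coeff 0 = 0 := by
    have := congrArg (coeff · 0) hG
    simpa [coeff_expand two_pos] using this
  obtain ⟨q, hq⟩ := X_dvd_iff.2 hr0
  have hGe : G = expand ℝ 2 p + X * expand ℝ 2 q := by
    rw [hq, map_mul, expand_X] at hG
    refine mul_left_cancel₀ X_ne_zero (hG.symm.trans ?_)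
    ring
  have hpn : p.coeff n = 0 := by
    rwa [coeff_reflect, revAt_le (Nat.zero_le n), Nat.sub_zero] at hr0
  have hp0 : p ≠ 0 := fun h => by simp [h] at hzero
  have hpdeg : p.natDegree ≤ n - 1 := by
    have : p.natDegree ≠ n := fun h =>
      hp0 (by rwa [← h, coeff_natDegree, leadingCoeff_eq_zero] at hpn)
    omega
  have hqn : ∀ k, q.coeff k = (reflect n p).coeff (k + 1) := fun k => by rw [hq, coeff_X_mul]
  have hq1 : q.coeff (n - 1) = 1 := by
    rw [hqn, coeff_reflect, show n - 1 + 1 = n by omega, revAt_le le_rfl, Nat.sub_self, hzero]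
  have hqdeg : q.natDegree = n - 1 := by
    refine le_antisymm ?_ (le_natDegree_of_ne_zero (by rw [hq1]; exact one_ne_zero))
    refine natDegree_le_iff_coeff_eq_zero.2 fun k hk => ?_
    rw [hqn, coeff_reflect, revAt_eq_self_of_lt (by omega)]
    exact coeff_eq_zero_of_natDegree_lt (by omega)
  rw [hq]
  refine IsHurwitz.interlaces (hGe ▸ hH) (hqdeg ▸ hpdeg) ?_ ?_
  · exact lt_of_le_of_ne (hcoeff _) (leadingCoeff_ne_zero.2 hp0).symm
  · rw [leadingCoeff, hqdeg, hq1]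
    exact one_pos

/-! ### Type A Eulerian polynomials and the type B theorem -/

/-- The Eulerian polynomials of type `A`, with constant term `1`. -/
noncomputable def eulerianA : ℕ → ℝ[X]
  | 0 => 1
  | n + 1 => (1 + (n : ℝ[X]) * X) * eulerianA n + X * (1 - X) * derivative (eulerianA n)

theorem eulerianA_succ (n : ℕ) : eulerianA (n + 1) =
    (1 + (n : ℝ[X]) * X) * eulerianA n + X * (1 - X) * derivative (eulerianA n) := rfl

theorem eulerianA_one : eulerianA 1 = 1 := by
  simp [eulerianA]

theorem eval_one_eulerianA (n : ℕ) : (eulerianA n).eval 1 = n.factorial := by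
  induction n with
  | zero => simp [eulerianA]
  | succ n ih =>
    rw [eulerianA_succ, Nat.factorial_succ]
    simp [ih, add_comm]

theorem eval_zero_eulerianA (n : ℕ) : (eulerianA n).eval 0 = 1 := by
  induction n with
  | zero => simp [eulerianA]
  | succ n ih =>
    rw [eulerianA_succ]
    simp [ih]

/-- The values 1 at 0 and `n!` at 1 differ. -/
theorem natDegree_eulerianA_ne_zero {n : ℕ} (hn : 2 ≤ n) : (eulerianA n).natDegree ≠ 0 := by
  intro h
  rw [natDegree_eq_zero] at h
  obtain ⟨c, hc⟩ := h
  have h0 := eval_zero_eulerianA n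
  have h1 := eval_one_eulerianA n
  rw [← hc, eval_C] at h0 h1
  rw [h0] at h1
  have h2 := Nat.self_le_factorial n
  have h3 : n.factorial = 1 := by exact_mod_cast h1.symm
  omega

theorem expand_lastSumB (n : ℕ) :
    X * expand ℝ 2 (lastSumB (fun x => 0 < x) (n + 1)) +
      expand ℝ 2 (lastSumB (fun x => x < 0) (n + 1)) =
    X * ((1 + X) ^ (n + 1) * eulerianA (n + 1)) := by
  induction n with
  | zero =>
    rw [zero_add, lastSumB_pos_one, lastSumB_neg_one, eulerianA_one]
    simp
    ring
  | succ n ih =>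
    have hd := congrArg derivative ih
    simp only [derivative_add, derivative_mul, derivative_X, derivative_expand, one_mul,
      derivative_pow, derivative_one, zero_add] at hd
    rw [lastSumB_pos_succ, lastSumB_neg_succ, lastSumB_true (Nat.succ_pos n),
      eulerianA_succ (n + 1)]
    simp only [map_add, map_mul, map_sub, map_one, map_natCast, map_ofNat, expand_X]
    simp only [Nat.cast_add, Nat.cast_one, Nat.add_sub_cancel,
      Nat.cast_ofNat, Nat.reduceSub, pow_one, mul_one, map_add, map_natCast, map_one] at hd ⊢
    -- If H is the left side of `ih` and N = n + 1, the two recurrences combine into the single one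
    -- H ↦ (t + (2N+1)t²) H + t(1-t²) H'.
    linear_combination (X + (2 * (n : ℝ[X]) + 3) * X ^ 2) * ih + X * (1 - X ^ 2) * hd

theorem one_sub_ne_zero_of_ne {z : ℂ} (h : z ≠ 1) : 1 - z ≠ 0 := sub_ne_zero.2 h.symm

theorem re_inv_nonneg {z : ℂ} (hz : 0 ≤ z.re) : 0 ≤ (1 / z).re := by
  rw [one_div, Complex.inv_re]
  exact div_nonneg hz (Complex.normSq_nonneg z)

/-- Induction through the half disc. The factor `(1 + X) ^ (n + 2)` is brought in only because the
product inherits the reciprocal symmetry from type B, and it has no zeros with nonnegative real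
part. -/
theorem isHurwitz_eulerianA (n : ℕ) : IsHurwitz (eulerianA (n + 1)) := by
  induction n with
  | zero =>
    rw [zero_add, eulerianA_one]
    intro z _
    simp
  | succ n ih =>
    have hdisc : ∀ z : ℂ, 0 ≤ z.re → ‖z‖ ≤ 1 → aeval z (eulerianA (n + 2)) ≠ 0 := by
      intro z hz hz1 h
      have hA := ih z hz
      rw [eulerianA_succ] at h
      simp only [map_add, map_mul, map_sub, map_one, map_natCast, aeval_X] at h
      by_cases hz0 : z = 0
      · rw [hz0] at h hA
        simp only [mul_zero, add_zero, one_mul, zero_mul] at h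
        exact hA h
      by_cases hz1' : z = 1
      · rw [hz1'] at h hA
        simp only [mul_one, sub_self, mul_zero, zero_mul, add_zero, mul_eq_zero, hA, or_false] at h
        have h2 : ((1 + (n + 1) : ℕ) : ℂ) = 0 := by
          rw [← h]
          push_cast
          ring
        exact absurd (Nat.cast_eq_zero.1 h2) (by omega)
      have h1z := one_sub_ne_zero_of_ne hz1'
      -- The recurrence divided by z(1-z)A(z), where A is the preceding polynomial. All three terms
      -- have nonnegative real part in the half disc, and the middle one is positive since Re z < 1
      -- there.
      have e : 1 / z + ((n + 2 : ℕ) : ℂ) * (1 / (1 - z)) +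
          aeval z (derivative (eulerianA (n + 1))) / aeval z (eulerianA (n + 1)) = 0 := by
        field_simp
        push_cast at h ⊢
        linear_combination h
      have hre := congrArg Complex.re e
      rw [Complex.add_re, Complex.add_re, Complex.zero_re, ← Complex.ofReal_natCast,
        Complex.re_ofReal_mul] at hre
      have h2 := re_inv_nonneg hz
      have h3 := (ih.re_logDeriv_nonneg hz).1
      have h4 : 0 < (1 / (1 - z)).re := by
        rw [one_div, Complex.inv_re]
        refine div_pos ?_ (Complex.normSq_pos.2 h1z)
        rw [Complex.sub_re, Complex.one_re, sub_pos]
        refine lt_of_le_of_ne ((Complex.re_le_norm z).trans hz1) fun h5 => hz1' ?_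
        have h6 := Complex.sq_norm z
        rw [Complex.normSq_apply, h5] at h6
        have h7 : z.im * z.im = 0 := by nlinarith [norm_nonneg z, mul_self_nonneg z.im]
        exact Complex.ext (by simp [h5]) (by simpa using h7)
      have h5 : (0 : ℝ) < ((n + 2 : ℕ) : ℝ) := by positivity
      nlinarith [mul_pos h5 h4]
    have hG := expand_lastSumB (n + 1)
    rw [lastSumB_neg (by omega)] at hG
    have hH := isHurwitz_of_symm (by rw [← halfB_eq (by omega)]; exact natDegree_halfB_le _) hG (by
      intro z hz hz1
      rw [map_mul, map_pow, map_add, map_one, aeval_X]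
      refine mul_ne_zero (pow_ne_zero _ fun h => ?_) (hdisc z hz hz1)
      have := congrArg Complex.re h
      rw [Complex.add_re, Complex.one_re, Complex.zero_re] at this
      linarith)
    intro z hz h
    exact hH z hz (by rw [map_mul, h, mul_zero])

theorem one_add_ne_zero_of_re_nonneg {z : ℂ} (hz : 0 ≤ z.re) : 1 + z ≠ 0 := fun h => by
  have := congrArg Complex.re h
  rw [Complex.add_re, Complex.one_re, Complex.zero_re] at this
  linarith

theorem isHurwitz_one_add_pow_mul_eulerianA (m n : ℕ) :
    IsHurwitz ((1 + X) ^ m * eulerianA (n + 1)) := by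
  intro z hz
  rw [map_mul, map_pow, map_add, map_one, aeval_X]
  exact mul_ne_zero (pow_ne_zero _ (one_add_ne_zero_of_re_nonneg hz)) (isHurwitz_eulerianA n z hz)

theorem coeff_lastSumB_nonneg (Q : ℤ → Prop) (n k : ℕ) : 0 ≤ (lastSumB Q n).coeff k := by
  classical
  unfold lastSumB
  rw [finsetSum_coeff]
  refine Finset.sum_nonneg fun π _ => ?_
  rw [finsetSum_coeff]
  refine Finset.sum_nonneg fun ε _ => ?_
  split_ifs
  · rw [coeff_X_pow]
    split_ifs <;> simp
  · simp

theorem coeff_lastSumD_nonneg (Q : ℤ → Prop) (n k : ℕ) : 0 ≤ (lastSumD Q n).coeff k := by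
  classical
  unfold lastSumD
  rw [finsetSum_coeff]
  refine Finset.sum_nonneg fun π _ => ?_
  rw [finsetSum_coeff]
  refine Finset.sum_nonneg fun ε _ => ?_
  split_ifs
  · rw [coeff_X_pow]
    split_ifs <;> simp
  · simp

theorem coeff_zero_lastSumB (n : ℕ) : (lastSumB (fun x => 0 < x) (n + 1)).coeff 0 = 1 ∧
    (lastSumB (fun x => x < 0) (n + 1)).coeff 0 = 0 := by
  induction n with
  | zero => rw [zero_add, lastSumB_pos_one, lastSumB_neg_one]; simp
  | succ n ih =>
    rw [lastSumB_pos_succ, lastSumB_neg_succ, lastSumB_true (Nat.succ_pos n)]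
    simp only [coeff_zero_eq_eval_zero] at ih ⊢
    simp [ih.1, ih.2]

theorem interlaces_and_realRooted_eulerianB {n : ℕ} (hn : 1 ≤ n) :
    Interlaces (halfB n) (reflect n (halfB n)) ∧
      eulerianB n = halfB n + reflect n (halfB n) ∧ HasOnlyRealZeros (eulerianB n) := by
  obtain ⟨m, rfl⟩ : ∃ m, n = m + 1 := ⟨n - 1, by omega⟩
  have hE : eulerianB (m + 1) = halfB (m + 1) + reflect (m + 1) (halfB (m + 1)) := by
    rw [eulerianB_eq, lastSumB_true hn, lastSumB_neg hn, halfB_eq hn]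
  have hG := expand_lastSumB m
  rw [lastSumB_neg hn, ← halfB_eq hn] at hG
  have h := interlaces_reflect_of_isHurwitz hn (natDegree_halfB_le _) hG
    (isHurwitz_one_add_pow_mul_eulerianA _ _) (fun k => by
      rw [halfB_eq hn]; exact coeff_lastSumB_nonneg _ _ k)
    (by rw [halfB_eq hn]; exact (coeff_zero_lastSumB m).1)
  exact ⟨h.1, hE, hE ▸ h.2⟩

/-! ### The type D theorem -/

/-- Reflecting in degree `m` and then in degree `m + 1` leaves a shift by one; this accounts for the
factor `X` in `reflect_halfD`. -/
theorem reflect_succ_reflect {m : ℕ} {p : ℝ[X]} (hp : p.natDegree ≤ m) :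
    reflect (m + 1) (reflect m p) = X * p := by
  ext k
  rw [coeff_reflect, coeff_reflect]
  rcases k with _ | k
  · rw [revAt_le (Nat.zero_le _), Nat.sub_zero, revAt_eq_self_of_lt (Nat.lt_succ_self m)]
    simp [coeff_eq_zero_of_natDegree_lt (Nat.lt_succ_of_le hp)]
  · rw [coeff_X_mul]
    by_cases hk : k ≤ m
    · rw [revAt_le (show k + 1 ≤ m + 1 by omega), revAt_le (show m + 1 - (k + 1) ≤ m by omega)]
      congr 1
      omega
    · rw [revAt_eq_self_of_lt (show m + 1 < k + 1 by omega),
        revAt_eq_self_of_lt (show m < k + 1 by omega), coeff_eq_zero_of_natDegree_lt (by omega),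
        coeff_eq_zero_of_natDegree_lt (by omega)]

theorem halfD_eq_sub (k : ℕ) : halfD (k + 2) =
    lastSumB (fun x => 0 < x) (k + 2) -
      ((k + 2 : ℕ) : ℝ[X]) * lastSumB (fun x => x < 0) (k + 1) := by
  rw [halfD_eq, lastSumB_eq_lastSumD_add, add_sub_cancel_right]

theorem reflect_halfD (k : ℕ) : reflect (k + 2) (halfD (k + 2)) =
    lastSumB (fun x => x < 0) (k + 2) -
      ((k + 2 : ℕ) : ℝ[X]) * (X * lastSumB (fun x => 0 < x) (k + 1)) := by
  have hd : (lastSumB (fun x => 0 < x) (k + 1)).natDegree ≤ k + 1 := by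
    rw [← halfB_eq (by omega)]
    exact natDegree_halfB_le _
  rw [halfD_eq_sub, lastSumB_neg (by omega), lastSumB_neg (by omega), ← reflect_succ_reflect hd,
    reflect_sub, ← C_eq_natCast, reflect_C_mul]

theorem expand_halfD (k : ℕ) :
    X * expand ℝ 2 (halfD (k + 2)) + expand ℝ 2 (reflect (k + 2) (halfD (k + 2))) =
      X * ((1 + X) ^ (k + 1) *
        ((1 + X) * eulerianA (k + 2) - ((k + 2 : ℕ) : ℝ[X]) * X * eulerianA (k + 1))) := by
  rw [reflect_halfD, halfD_eq_sub]
  simp only [map_sub, map_mul, map_natCast, expand_X]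
  have h1 := expand_lastSumB (k + 1)
  have h2 := expand_lastSumB k
  linear_combination h1 - ((k + 2 : ℕ) : ℝ[X]) * X * h2

/-- Only n = k + 3 ≥ 3 is covered: for n = 2 the second factor is 1 + t², with zeros ±i on the
boundary. -/
theorem isHurwitz_typeD (k : ℕ) : IsHurwitz ((1 + X) ^ (k + 2) *
    ((1 + X) * eulerianA (k + 3) - ((k + 3 : ℕ) : ℝ[X]) * X * eulerianA (k + 2))) := by
  refine isHurwitz_of_symm (natDegree_halfD_le _) (expand_halfD (k + 1)) fun z hz hz1 => ?_
  have h1z := one_add_ne_zero_of_re_nonneg hz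
  rw [map_mul, map_pow, map_add, map_one, aeval_X]
  refine mul_ne_zero (pow_ne_zero _ h1z) fun h => ?_
  have hA := isHurwitz_eulerianA (k + 1) z hz
  rw [eulerianA_succ] at h
  simp only [map_add, map_mul, map_sub, map_one, map_natCast, aeval_X] at h
  have h' : (1 + ((k + 2 : ℕ) : ℂ) * z ^ 2) * aeval z (eulerianA (k + 2)) +
      z * (1 - z) * (1 + z) * aeval z (derivative (eulerianA (k + 2))) = 0 := by
    push_cast at h ⊢
    linear_combination h
  by_cases hz0 : z = 0
  · rw [hz0] at h' hA
    simp only [zero_pow two_ne_zero, mul_zero, add_zero, one_mul, zero_mul] at h'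
    exact hA h'
  by_cases hz1' : z = 1
  · rw [hz1'] at h' hA
    simp only [one_pow, mul_one, sub_self, mul_zero, zero_mul, add_zero, mul_eq_zero, hA,
      or_false] at h'
    have h2 : ((1 + (k + 2) : ℕ) : ℂ) = 0 := by
      rw [← h']
      push_cast
      ring
    exact absurd (Nat.cast_eq_zero.1 h2) (by omega)
  have h1z' := one_sub_ne_zero_of_ne hz1'
  -- Substituting the recurrence leaves (1 + (n-1)z²)A + z(1-z²)A', with n = k + 3 and A the
  -- Eulerian polynomial of index n - 1; this is divided by z(1-z²)A. At z = ±i the first two terms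
  -- are purely imaginary, so positivity must come from A'/A, which needs A nonconstant.
  have e : 1 / z + ((k + 3 : ℕ) : ℂ) * (z / ((1 - z) * (1 + z))) +
      aeval z (derivative (eulerianA (k + 2))) / aeval z (eulerianA (k + 2)) = 0 := by
    field_simp
    push_cast at h' ⊢
    linear_combination h'
  have hre := congrArg Complex.re e
  rw [Complex.add_re, Complex.add_re, Complex.zero_re, ← Complex.ofReal_natCast,
    Complex.re_ofReal_mul] at hre
  have h2 := re_inv_nonneg hz
  have h3 := ((isHurwitz_eulerianA (k + 1)).re_logDeriv_nonneg hz).2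
    (natDegree_eulerianA_ne_zero (by omega))
  have h4 : 0 ≤ (z / ((1 - z) * (1 + z))).re := by
    rw [Complex.div_re, ← add_div]
    refine div_nonneg ?_ (Complex.normSq_nonneg _)
    have h5 : z.re * z.re + z.im * z.im ≤ 1 := by
      rw [← Complex.normSq_apply, ← Complex.sq_norm]
      exact pow_le_one₀ (norm_nonneg z) hz1
    have h6 : z.re * ((1 - z) * (1 + z)).re + z.im * ((1 - z) * (1 + z)).im =
        z.re * (1 - (z.re * z.re + z.im * z.im)) := by
      simp only [Complex.mul_re, Complex.mul_im, Complex.sub_re, Complex.sub_im, Complex.add_re,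
        Complex.add_im, Complex.one_re, Complex.one_im]
      ring
    rw [h6]
    exact mul_nonneg hz (by linarith)
  have h5 : (0 : ℝ) ≤ ((k + 3 : ℕ) : ℝ) := by positivity
  have h6 := mul_nonneg h5 h4
  linarith

/-- The case n = 2 of type D, out of reach of the Hurwitz criterion: the halves are x + 1 and x(x +
1), with the common zero -1. -/
theorem interlaces_X_add_one : Interlaces (X + C 1) (X * (X + C 1)) ∧
    HasOnlyRealZeros (X + C 1 + X * (X + C 1)) := by
  have hne : (X + C 1 : ℝ[X]) ≠ 0 := X_add_C_ne_zero 1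
  have hne2 : X * (X + C 1 : ℝ[X]) ≠ 0 := mul_ne_zero X_ne_zero hne
  have hz : ∀ z : ℂ, z + 1 = 0 → z.im = 0 := fun z h => by
    rw [eq_neg_of_add_eq_zero_left h]
    simp
  have hroots : (X + C 1 : ℝ[X]).roots = {-1} := roots_X_add_C 1
  refine ⟨⟨⟨hne, fun z h => hz z (by simpa using h)⟩, ⟨hne2, fun z h => ?_⟩, ?_, ?_,
    [0, -1], [-1], ?_, ?_, ?_, ?_, ?_, ?_, ?_⟩, ?_, fun z h => ?_⟩
  · rw [map_mul, aeval_X, mul_eq_zero] at h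
    rcases h with h | h
    · simp [h]
    · exact hz z (by simpa using h)
  · rw [leadingCoeff_X_add_C]
    exact one_pos
  · rw [leadingCoeff_mul, leadingCoeff_X_add_C, leadingCoeff_X]
    norm_num
  · rw [roots_mul hne2, hroots, roots_X]
    rfl
  · rw [hroots]
    rfl
  · simp
  · simp
  · simp
  · intro i hr hs
    have : i = 0 := by simpa using hs
    subst this
    simp
  · intro i hr hs
    have : i = 0 := by simpa using hs
    subst this
    simp
  · rw [show X + C 1 + X * (X + C 1) = (X + C 1) * (X + C 1 : ℝ[X]) by rw [C_1]; ring]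
    exact mul_ne_zero hne hne
  · rw [show X + C 1 + X * (X + C 1) = (X + C 1) * (X + C 1 : ℝ[X]) by rw [C_1]; ring, map_mul,
      mul_self_eq_zero] at h
    exact hz z (by simpa using h)

theorem interlaces_and_realRooted_eulerianD {n : ℕ} (hn : 2 ≤ n) :
    Interlaces (halfD n) (reflect n (halfD n)) ∧
      eulerianD n = halfD n + reflect n (halfD n) ∧ HasOnlyRealZeros (eulerianD n) := by
  obtain ⟨k, rfl⟩ : ∃ k, n = k + 2 := ⟨n - 2, by omega⟩
  have hE : eulerianD (k + 2) = halfD (k + 2) + reflect (k + 2) (halfD (k + 2)) := by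
    rw [eulerianD_eq, lastSumD_neg, halfD_eq]
  suffices h : Interlaces (halfD (k + 2)) (reflect (k + 2) (halfD (k + 2))) ∧
      HasOnlyRealZeros (halfD (k + 2) + reflect (k + 2) (halfD (k + 2))) from
    ⟨h.1, hE, hE ▸ h.2⟩
  rcases k with _ | k
  · have h1 : halfD (0 + 2) = X + C 1 := by
      rw [halfD_eq_sub, lastSumB_pos_succ, zero_add, lastSumB_true le_rfl, lastSumB_pos_one,
        lastSumB_neg_one, C_1]
      simp
      ring
    have h2 : reflect (0 + 2) (halfD (0 + 2)) = X * (X + C 1) := by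
      rw [reflect_halfD, lastSumB_neg_succ, zero_add, lastSumB_true le_rfl, lastSumB_pos_one,
        lastSumB_neg_one, C_1]
      simp
      ring
    rw [h2, h1]
    exact interlaces_X_add_one
  · refine interlaces_reflect_of_isHurwitz (by omega) (natDegree_halfD_le _) (expand_halfD (k + 1))
      (isHurwitz_typeD k) (fun j => by rw [halfD_eq]; exact coeff_lastSumD_nonneg _ _ j) ?_
    rw [halfD_eq_sub, ← C_eq_natCast, coeff_sub, coeff_C_mul, (coeff_zero_lastSumB _).1,
      (coeff_zero_lastSumB _).2, mul_zero, sub_zero]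

theorem mainTheorem2 :
    (∀ n : ℕ, 1 ≤ n →
      Interlaces (halfB n) (reflect n (halfB n)) ∧
      eulerianB n = halfB n + reflect n (halfB n) ∧
      HasOnlyRealZeros (eulerianB n)) ∧
    (∀ n : ℕ, 2 ≤ n →
      Interlaces (halfD n) (reflect n (halfD n)) ∧
      eulerianD n = halfD n + reflect n (halfD n) ∧
      HasOnlyRealZeros (eulerianD n)) :=
  ⟨fun _ hn => interlaces_and_realRooted_eulerianB hn,
    fun _ hn => interlaces_and_realRooted_eulerianD hn⟩
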